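/- Let $n\ge 2$ and $s\in(0,1)\setminus\{\tfrac12\}$, and let $f=(f_{j_1j_2})$ be a symmetric $2$-tensor field on $\mathbb R^n$ with components in the complex-valued Schwartz space $\mathcal S(\mathbb R^n)$. For $x\in\mathbb R^n$ and $\xi\in\mathbb S^{n-1}$ let $$(\chi_{s,2}f)(x,\xi)=\int_0^\infty t^{2s-1}\sum_{j_1,j_2=1}^n f_{j_1j_2}(x+t\xi)\,\xi^{j_1}\xi^{j_2}\,dt$$ be the fractional divergent beam ray transform of $f$, and for $k=0,1,2$ and $1\le i_1,\dots,i_k\le n$ let $$(A^{k,i_1\cdots i_k}f)(x)=c_k\int_{\mathbb S^{n-1}}\xi^{i_1}\cdots\xi^{i_k}\,(\chi_{s,2}f)(x,\xi)\,dS_\xi,$$ $$c_k=\frac{-\Gamma\left(\frac{n+2+k-2s}{2}\right)}{2^{2s-\lfloor (2+k)/2\rfloor}\,\pi^{n/2}\,\Gamma\left(s+\frac{(2+k)\bmod 2}{2}\right)},$$ where $dS$ is the surface measure. With $\widehat u(y)=\int e^{-i\langle x,y\rangle}u(x)\,dx$, extended to tempered distributions, let the Riesz transforms $R_j$ and the fractional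 Laplacian $(-\Delta)^s$ be the Fourier multipliers $\widehat{R_ju}(y)=-i\frac{y_j}{|y|}\widehat u(y)$ and $\widehat{(-\Delta)^su}(y)=|y|^{2s}\widehat u(y)$, defined for tempered distributions $u$ such that $\widehat u$ is a function and the right-hand side is a tempered distribution. Then the integrals above converge absolutely, the averages are functions that define tempered distributions, all operators in the following formula are applied within their domains, and for all $1\le i_1,i_2\le n$ $$f_{i_1i_2}=\tfrac12(-\Delta)^s\Big[\delta_{i_1i_2}A^0f-2s\,R_{i_1}R_{i_2}A^0f-A^{2,i_1i_2}f-2s\big(R_{i_1}A^{1,i_2}f+R_{i_2}A^{1,i_1}f\big)\Big]$$ as tempered distributions. -/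

import Mathlib

open MeasureTheory Set
open scoped SchwartzMap FourierTransform

noncomputable section

namespace FracBeam

/-- Euclidean space `ℝⁿ`. -/
abbrev E (n : ℕ) : Type := EuclideanSpace ℝ (Fin n)

/-- A symmetric `m`-tensor field on `ℝⁿ` whose Cartesian components `f_{J 0 ⋯ J (m-1)}` are
complex-valued Schwartz functions. -/
structure SymTensorField (n m : ℕ) where
  /-- The Cartesian components. -/
  comp : (Fin m → Fin n) → 𝓢(E n, ℂ)
  /-- The components are symmetric with respect to all indices. -/
  symm : ∀ (π : Equiv.Perm (Fin m)) (J : Fin m → Fin n), comp (J ∘ π) = comp J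

variable {n m k : ℕ}

/-- The integrand `t^{2s-1} f_{j₁⋯jₘ}(x + tξ) ξ^{j₁} ⋯ ξ^{jₘ}`, summed over repeated indices. -/
def beamIntegrand (s : ℝ) (f : SymTensorField n m) (x ξ : E n) (t : ℝ) : ℂ :=
  ((t ^ (2 * s - 1) : ℝ) : ℂ) *
    ∑ J : Fin m → Fin n, f.comp J (x + t • ξ) * ∏ a, ((ξ (J a) : ℝ) : ℂ)

/-- The fractional divergent beam ray transform `(χ_{s,m} f)(x, ξ)`. -/
def beamTransform (s : ℝ) (f : SymTensorField n m) (x ξ : E n) : ℂ :=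
  ∫ t in Ioi (0 : ℝ), beamIntegrand s f x ξ t

/-- The normalizing constant `c_{n,s}^{m,k}`. The two divisions `(m + k) / 2` and `(m + k) % 2`
inside the casts are integer quotient and remainder. -/
def avgConst (n : ℕ) (s : ℝ) (m k : ℕ) : ℝ :=
  -Real.Gamma ((n + m + k - 2 * s) / 2) /
    ((2 : ℝ) ^ (2 * s - (((m + k) / 2 : ℕ) : ℝ)) * Real.pi ^ ((n : ℝ) / 2) *
      Real.Gamma (s + (((m + k) % 2 : ℕ) : ℝ) / 2))

/-- The function `ξ ↦ ξ^{i₁} ⋯ ξ^{i_k} (χ_{s,m} f)(x, ξ)` on the unit sphere. -/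
def averageIntegrand (s : ℝ) (f : SymTensorField n m) (I : Fin k → Fin n) (x : E n)
    (ξ : Metric.sphere (0 : E n) 1) : ℂ :=
  (∏ a, (((ξ : E n) (I a) : ℝ) : ℂ)) * beamTransform s f x ξ

/-- The average `(A_{m,s}^{k,i₁,…,i_k} f)(x)`, an integral over the unit sphere with respect to
the (unnormalized) surface measure. -/
def average (s : ℝ) (f : SymTensorField n m) (I : Fin k → Fin n) (x : E n) : ℂ :=
  (avgConst n s m k : ℂ) *
    ∫ ξ, averageIntegrand s f I x ξ ∂((volume : Measure (E n)).toSphere)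

/-- The tempered distribution `T` is given by the function `u`. -/
def IsGivenBy (T : 𝓢'(E n, ℂ)) (u : E n → ℂ) : Prop :=
  ∀ φ : 𝓢(E n, ℂ), Integrable (fun x => φ x * u x) ∧ T φ = ∫ x, φ x * u x

/-- The function `u` defines a tempered distribution by integration. -/
def IsTempered (u : E n → ℂ) : Prop := ∃ T : 𝓢'(E n, ℂ), IsGivenBy T u

open Classical in
/-- The tempered distribution defined by the function `u` (zero if `u` defines none). -/
def toDistribution (u : E n → ℂ) : 𝓢'(E n, ℂ) :=
  if h : IsTempered u then h.choose else 0

/-- The average `A_{m,s}^{k,i₁,…,i_k} f` as a tempered distribution. -/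
def averageDist (s : ℝ) (f : SymTensorField n m) (I : Fin k → Fin n) : 𝓢'(E n, ℂ) :=
  toDistribution (average s f I)

/-- `v = σ(D) u`: the Fourier transform of `u` is a function `U`, and the Fourier transform of `v`
is the function `σ U`. Symbols are written for the Fourier transform with kernel
`exp (-i ⟨x, y⟩)`; the transform `𝓕` has kernel `exp (-2πi ⟨x, ξ⟩)`, so `y = 2πξ`. -/
def IsMultiplierImage (σ : E n → ℂ) (u v : 𝓢'(E n, ℂ)) : Prop :=
  ∃ U : E n → ℂ, IsGivenBy (𝓕 u) U ∧
    IsGivenBy (𝓕 v) (fun ξ => σ ((2 * Real.pi) • ξ) * U ξ)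

/-- `u` lies in the domain of the Fourier multiplier operator `σ(D)`. -/
def MultiplierDefined (σ : E n → ℂ) (u : 𝓢'(E n, ℂ)) : Prop :=
  ∃ v, IsMultiplierImage σ u v

open Classical in
/-- The Fourier multiplier operator `σ(D)` on tempered distributions (zero off its domain). -/
def multiplier (σ : E n → ℂ) (u : 𝓢'(E n, ℂ)) : 𝓢'(E n, ℂ) :=
  if h : MultiplierDefined σ u then h.choose else 0

/-- The symbol `-i y_j / |y|` of the `j`-th Riesz transform. -/
def rieszSymbol (j : Fin n) (y : E n) : ℂ := -Complex.I * ((y j / ‖y‖ : ℝ) : ℂ)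

/-- The symbol `|y|^{2s}` of the fractional Laplacian `(-Δ)^s`. -/
def fracLaplacianSymbol (s : ℝ) (y : E n) : ℂ := ((‖y‖ ^ (2 * s) : ℝ) : ℂ)

/-- The Riesz transform `R_j`. -/
def riesz (j : Fin n) (u : 𝓢'(E n, ℂ)) : 𝓢'(E n, ℂ) := multiplier (rieszSymbol j) u

/-- `R_j u` is well-defined. -/
def RieszDefined (j : Fin n) (u : 𝓢'(E n, ℂ)) : Prop := MultiplierDefined (rieszSymbol j) u

/-- The fractional Laplacian `(-Δ)^s`. -/
def fracLaplacian (s : ℝ) (u : 𝓢'(E n, ℂ)) : 𝓢'(E n, ℂ) := multiplier (fracLaplacianSymbol s) u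

/-- `(-Δ)^s u` is well-defined. -/
def FracLaplacianDefined (s : ℝ) (u : 𝓢'(E n, ℂ)) : Prop :=
  MultiplierDefined (fracLaplacianSymbol s) u

end FracBeam

end

open MeasureTheory Set
open scoped SchwartzMap FourierTransform
open scoped ContDiff

noncomputable section

namespace FracBeam

section Integrability

variable {V : Type*} [NormedAddCommGroup V] [NormedSpace ℝ V] [FiniteDimensional ℝ V]
  [MeasurableSpace V] [BorelSpace V] {μ : Measure V} [μ.IsAddHaarMeasure]

/-- A function bounded by `C ‖x‖ ^ p` with `p > -dim V` times a Schwartz function is integrable. -/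
theorem integrable_mul_schwartz_of_norm_le_rpow (hd : 1 ≤ Module.finrank ℝ V) {p C : ℝ}
    (hp : -(Module.finrank ℝ V : ℝ) < p) {u : V → ℂ} (hu : AEStronglyMeasurable u μ)
    (hb : ∀ x, x ≠ 0 → ‖u x‖ ≤ C * ‖x‖ ^ p) (g : 𝓢(V, ℂ)) :
    Integrable (fun x => u x * g x) μ := by
  have hV : Nontrivial V := Module.nontrivial_of_finrank_pos (R := ℝ) (by omega)
  have hmeas : AEStronglyMeasurable (fun x => u x * g x) μ :=
    hu.mul g.continuous.aestronglyMeasurable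
  have hne : ∀ᵐ x ∂μ, x ≠ 0 := by
    simp [ae_iff]
  obtain ⟨B, hB⟩ : ∃ B, ∀ x, ‖g x‖ ≤ B := by
    obtain ⟨B, hB⟩ := (BoundedContinuousFunction.isBounded_range
      g.toBoundedContinuousFunction).exists_norm_le
    exact ⟨B, fun x => hB _ ⟨x, rfl⟩⟩
  have hC : 0 ≤ C := by
    obtain ⟨x, hx⟩ := exists_ne (0 : V)
    have h1 := (norm_nonneg _).trans (hb x hx)
    have h2 : 0 < ‖x‖ ^ p := Real.rpow_pos_of_pos (norm_pos_iff.2 hx) _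
    exact nonneg_of_mul_nonneg_left h1 h2
  have h1 : IntegrableOn (fun x => u x * g x) (Metric.ball 0 1) μ := by
    refine integrableOn_ball_of_norm_le_rpow hd (C := C * B) (α := -p) (by linarith) ?_ hmeas
    refine ae_restrict_of_ae (hne.mono fun x hx => ?_)
    rw [norm_mul, neg_neg]
    have := hB x
    have h3 : 0 ≤ ‖x‖ ^ p := by positivity
    calc ‖u x‖ * ‖g x‖ ≤ (C * ‖x‖ ^ p) * B :=
          mul_le_mul (hb x hx) this (norm_nonneg _) (by positivity)
      _ = _ := by ring
  obtain ⟨k, hk⟩ := exists_nat_ge p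
  have h2 : IntegrableOn (fun x => u x * g x) (Metric.ball 0 1)ᶜ μ := by
    refine Integrable.mono' (((g.integrable_pow_mul μ k).const_mul C).integrableOn)
      hmeas.restrict ?_
    refine (ae_restrict_iff' measurableSet_ball.compl).2 (hne.mono fun x hx hx1 => ?_)
    have hx1 : 1 ≤ ‖x‖ := by simpa using hx1
    rw [norm_mul, ← mul_assoc]
    refine mul_le_mul_of_nonneg_right ((hb x hx).trans ?_) (norm_nonneg _)
    refine mul_le_mul_of_nonneg_left ?_ hC
    rw [← Real.rpow_natCast]
    exact Real.rpow_le_rpow_of_exponent_le hx1 hk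
  have := h1.union h2
  rwa [union_compl_self, integrableOn_univ] at this

end Integrability

section Gamma

/-- The integrand of the Gamma integral with a scale. -/
theorem integrableOn_rpow_mul_exp_neg_mul {q c : ℝ} (hq : 0 < q) (hc : 0 < c) :
    IntegrableOn (fun b : ℝ => b ^ (q - 1) * Real.exp (-(c * b))) (Ioi 0) := by
  simpa using integrableOn_rpow_mul_exp_neg_mul_rpow (p := 1) (s := q - 1) (b := c)
    (by linarith) one_pos hc

theorem integrableOn_rpow_mul_exp_neg_div {p c : ℝ} (hp : 0 < p) (hc : 0 < c) :
    IntegrableOn (fun b : ℝ => b ^ (-p - 1) * Real.exp (-(c / b))) (Ioi 0) := by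
  have h := (integrableOn_Ioi_comp_rpow_iff' (fun b : ℝ => b ^ (p - 1) * Real.exp (-(c * b)))
    (p := -1) (by norm_num)).2 (integrableOn_rpow_mul_exp_neg_mul hp hc)
  refine h.congr_fun (fun b hb => ?_) measurableSet_Ioi
  have hb : 0 < b := hb
  simp only [smul_eq_mul]
  rw [← mul_assoc, ← Real.rpow_mul hb.le, ← Real.rpow_add hb, Real.rpow_neg_one, div_eq_mul_inv]
  ring_nf

theorem integral_rpow_mul_exp_neg_div {p c : ℝ} (hp : 0 < p) (hc : 0 < c) :
    ∫ b in Ioi (0 : ℝ), b ^ (-p - 1) * Real.exp (-(c / b)) = c ^ (-p) * Real.Gamma p := by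
  have h := integral_comp_rpow_Ioi (fun b : ℝ => b ^ (p - 1) * Real.exp (-(c * b)))
    (p := -1) (by norm_num)
  rw [Real.integral_rpow_mul_exp_neg_mul_Ioi hp hc, one_div, Real.inv_rpow hc.le,
    ← Real.rpow_neg hc.le] at h
  rw [← h]
  refine setIntegral_congr_fun measurableSet_Ioi (fun b hb => ?_)
  have hb : 0 < b := hb
  simp only [smul_eq_mul, abs_neg, abs_one, one_mul]
  rw [← mul_assoc, ← Real.rpow_mul hb.le, ← Real.rpow_add hb, Real.rpow_neg_one, div_eq_mul_inv]
  ring_nf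

end Gamma

variable {n k : ℕ}

theorem one_le_finrank (hn : 1 ≤ n) : 1 ≤ Module.finrank ℝ (E n) := by simpa using hn

/-- Fubini's theorem for a nonnegative kernel `k z b` integrated over `b > 0`. -/
theorem integral_kernel_swap (hn : 1 ≤ n) {k : E n → ℝ → ℝ} (hk : Measurable (Function.uncurry k))
    (hk0 : ∀ z, ∀ b, 0 < b → 0 ≤ k z b) (hki : ∀ z, z ≠ 0 → IntegrableOn (k z) (Ioi 0))
    {K : E n → ℝ} (hK : ∀ z, z ≠ 0 → ∫ b in Ioi (0 : ℝ), k z b = K z)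
    {u : E n → ℂ} (hu : AEStronglyMeasurable u) (hint : Integrable fun z => (K z : ℂ) * u z) :
    IntegrableOn (fun b => ∫ z, (k z b : ℂ) * u z) (Ioi 0) ∧
      ∫ b in Ioi (0 : ℝ), ∫ z, (k z b : ℂ) * u z = ∫ z, (K z : ℂ) * u z := by
  have hV : Nontrivial (E n) := Module.nontrivial_of_finrank_pos (R := ℝ) (one_le_finrank hn)
  have hne : ∀ᵐ z : E n, z ≠ 0 := by
    simp [ae_iff]
  have hprod : Integrable (fun w : E n × ℝ => (k w.1 w.2 : ℂ) * u w.1)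
      (volume.prod (volume.restrict (Ioi 0))) := by
    have hm : AEStronglyMeasurable (fun w : E n × ℝ => (k w.1 w.2 : ℂ) * u w.1)
        (volume.prod (volume.restrict (Ioi 0))) := by
      have h1 : Measurable fun w : E n × ℝ => (k w.1 w.2 : ℂ) := Complex.measurable_ofReal.comp hk
      exact h1.aestronglyMeasurable.mul hu.comp_fst
    refine (integrable_prod_iff hm).2 ⟨hne.mono fun z hz => ?_, ?_⟩
    · have h1 : Integrable (fun b => (k z b : ℂ)) (volume.restrict (Ioi 0)) := (hki z hz).ofReal
      exact h1.mul_const (u z)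
    · refine hint.norm.congr (hne.mono fun z hz => ?_)
      simp only [norm_mul, Complex.norm_real]
      rw [integral_mul_const, ← hK z hz]
      congr 1
      rw [Real.norm_of_nonneg (setIntegral_nonneg measurableSet_Ioi (hk0 z))]
      refine setIntegral_congr_fun measurableSet_Ioi fun b hb => ?_
      exact (Real.norm_of_nonneg (hk0 z b hb)).symm
  refine ⟨hprod.integral_prod_right, ?_⟩
  rw [← integral_integral_swap hprod]
  refine integral_congr_ae (hne.mono fun z hz => ?_)
  simp only
  rw [integral_mul_const, integral_complex_ofReal, hK z hz]

/-- Integrating a family of Gaussian Parseval identities over the width of the Gaussian gives a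
Parseval identity for homogeneous kernels. -/
theorem integral_homogeneous_kernel (hn : 1 ≤ n) {s : ℝ} (hs : 0 < s) (hsn : 2 * s < n) (l : ℕ)
    {m : E n → ℂ} (hm : Continuous m) {Cm : ℝ} (hmb : ∀ z, ‖m z‖ ≤ Cm * ‖z‖ ^ l)
    {R : Finset ℕ} (hR : ∀ r ∈ R, l ≤ 2 * r) {M : ℕ → E n → ℂ} (hM : ∀ r ∈ R, Continuous (M r))
    (hMb : ∀ r ∈ R, ∃ C, ∀ y, ‖M r y‖ ≤ C * ‖y‖ ^ (2 * r - l)) {κ : ℂ} {g G : 𝓢(E n, ℂ)}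
    (h : ∀ b : ℝ, 0 < b →
      ∫ z, ((Real.exp (-(Real.pi ^ 2 * ‖z‖ ^ 2 / b)) : ℝ) : ℂ) * (m z * g z) =
        ((b ^ ((n : ℝ) / 2) : ℝ) : ℂ) * (κ *
          ∫ y, ((Real.exp (-(‖y‖ ^ 2 * b)) : ℝ) : ℂ) * ((∑ r ∈ R, (b : ℂ) ^ r * M r y) * G y))) :
    ((Real.pi ^ (2 * s - l - n) * Real.Gamma ((n + l - 2 * s) / 2) : ℝ) : ℂ) *
        ∫ z, ((‖z‖ ^ (2 * s - l - n) : ℝ) : ℂ) * (m z * g z) =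
      κ * ∫ y, (∑ r ∈ R, ((Real.Gamma (s + r - l / 2) * ‖y‖ ^ (l - 2 * r - 2 * s) : ℝ) : ℂ) *
        M r y) * G y := by
  have hfr : (Module.finrank ℝ (E n) : ℝ) = n := by simp
  have hn1 : (1 : ℝ) ≤ n := by exact_mod_cast hn
  have hl0 : (0 : ℝ) ≤ l := Nat.cast_nonneg l
  -- spatial side
  set p : ℝ := (n + l - 2 * s) / 2 with hp
  have hp0 : 0 < p := by rw [hp]; linarith
  have hpow : ∀ z : E n, z ≠ 0 → (Real.pi ^ 2 * ‖z‖ ^ 2) ^ (-p) * Real.Gamma p =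
      (Real.pi ^ (2 * s - l - n) * Real.Gamma p) * ‖z‖ ^ (2 * s - l - n) := by
    intro z hz
    rw [← mul_pow, ← Real.rpow_natCast, ← Real.rpow_mul (by positivity),
      show ((2 : ℕ) : ℝ) * -p = 2 * s - l - n by rw [hp]; push_cast; ring,
      Real.mul_rpow Real.pi_pos.le (norm_nonneg _)]
    ring
  have hZint : Integrable fun z : E n => ((‖z‖ ^ (2 * s - l - n) : ℝ) : ℂ) * (m z * g z) := by
    have := integrable_mul_schwartz_of_norm_le_rpow (μ := (volume : Measure (E n)))
      (one_le_finrank hn) (p := 2 * s - n) (C := Cm)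
      (by rw [hfr]; linarith) (u := fun z => ((‖z‖ ^ (2 * s - l - n) : ℝ) : ℂ) * m z)
      ((Complex.measurable_ofReal.comp (measurable_norm.pow_const _)).aestronglyMeasurable.mul
        hm.aestronglyMeasurable) ?_ g
    · simpa only [mul_assoc] using this
    · intro z hz
      have hz : 0 < ‖z‖ := norm_pos_iff.2 hz
      rw [norm_mul, Complex.norm_real, Real.norm_of_nonneg (by positivity)]
      calc ‖z‖ ^ (2 * s - l - n) * ‖m z‖ ≤ ‖z‖ ^ (2 * s - l - n) * (Cm * ‖z‖ ^ l) := by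
            gcongr; exact hmb z
        _ = Cm * (‖z‖ ^ (2 * s - l - n) * ‖z‖ ^ (l : ℝ)) := by rw [Real.rpow_natCast]; ring
        _ = _ := by rw [← Real.rpow_add hz]; ring_nf
  have hZ := integral_kernel_swap hn
    (k := fun z b => b ^ (-p - 1) * Real.exp (-(Real.pi ^ 2 * ‖z‖ ^ 2 / b)))
    (by unfold Function.uncurry; fun_prop)
    (fun z b hb => by positivity)
    (fun z hz => integrableOn_rpow_mul_exp_neg_div hp0
      (mul_pos (by positivity) (pow_pos (norm_pos_iff.2 hz) 2)))
    (K := fun z => (Real.pi ^ (2 * s - l - n) * Real.Gamma p) * ‖z‖ ^ (2 * s - l - n))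
    (fun z hz => by
      rw [integral_rpow_mul_exp_neg_div hp0
        (mul_pos (by positivity) (pow_pos (norm_pos_iff.2 hz) 2)), hpow z hz])
    (u := fun z => m z * g z) (hm.mul g.continuous).aestronglyMeasurable
    (by simpa only [Complex.ofReal_mul, mul_assoc] using hZint.const_mul
          ((Real.pi ^ (2 * s - l - n) * Real.Gamma p : ℝ) : ℂ))
  -- frequency side
  have hq : ∀ r ∈ R, 0 < s + r - l / 2 := by
    intro r hr
    have : (l : ℝ) ≤ 2 * r := by exact_mod_cast hR r hr
    linarith
  have hYint : ∀ r ∈ R, Integrable fun y : E n =>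
      ((Real.Gamma (s + r - l / 2) * ‖y‖ ^ (l - 2 * r - 2 * s) : ℝ) : ℂ) * (M r y * G y) := by
    intro r hr
    obtain ⟨C, hC⟩ := hMb r hr
    have := integrable_mul_schwartz_of_norm_le_rpow (μ := (volume : Measure (E n)))
      (one_le_finrank hn) (p := -(2 * s)) (C := C)
      (by rw [hfr]; linarith) (u := fun y => ((‖y‖ ^ (l - 2 * r - 2 * s) : ℝ) : ℂ) * M r y)
      ((Complex.measurable_ofReal.comp (measurable_norm.pow_const _)).aestronglyMeasurable.mul
        (hM r hr).aestronglyMeasurable) ?_ G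
    · simpa only [mul_assoc, Complex.ofReal_mul] using this.const_mul
        ((Real.Gamma (s + r - l / 2) : ℝ) : ℂ)
    · intro z hz
      have hz : 0 < ‖z‖ := norm_pos_iff.2 hz
      rw [norm_mul, Complex.norm_real, Real.norm_of_nonneg (by positivity)]
      calc ‖z‖ ^ (l - 2 * r - 2 * s) * ‖M r z‖
          ≤ ‖z‖ ^ (l - 2 * r - 2 * s) * (C * ‖z‖ ^ (2 * r - l)) := by
            gcongr; exact hC z
        _ = C * (‖z‖ ^ (l - 2 * r - 2 * s) * ‖z‖ ^ ((2 * r - l : ℕ) : ℝ)) := by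
            rw [Real.rpow_natCast]; ring
        _ = _ := by
            rw [← Real.rpow_add hz, Nat.cast_sub (hR r hr)]; push_cast; ring_nf
  have hY : ∀ r ∈ R, _ := fun r hr => integral_kernel_swap hn
    (k := fun y b => b ^ (s + r - l / 2 - 1) * Real.exp (-(‖y‖ ^ 2 * b)))
    (by unfold Function.uncurry; fun_prop)
    (fun z b hb => by positivity)
    (fun z hz => integrableOn_rpow_mul_exp_neg_mul (hq r hr) (pow_pos (norm_pos_iff.2 hz) 2))
    (K := fun y => Real.Gamma (s + r - l / 2) * ‖y‖ ^ (l - 2 * r - 2 * s))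
    (fun z hz => by
      rw [Real.integral_rpow_mul_exp_neg_mul_Ioi (hq r hr) (pow_pos (norm_pos_iff.2 hz) 2),
        one_div, Real.inv_rpow (by positivity), ← Real.rpow_neg (by positivity),
        ← Real.rpow_natCast, ← Real.rpow_mul (by positivity), mul_comm]
      congr 2
      push_cast; ring)
    (u := fun y => M r y * G y) ((hM r hr).mul G.continuous).aestronglyMeasurable (hYint r hr)
  -- comparison
  have hstep : ∀ b ∈ Ioi (0 : ℝ),
      ∫ z, ((b ^ (-p - 1) * Real.exp (-(Real.pi ^ 2 * ‖z‖ ^ 2 / b)) : ℝ) : ℂ) * (m z * g z) =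
      κ * ∑ r ∈ R, ∫ y, ((b ^ (s + r - l / 2 - 1) * Real.exp (-(‖y‖ ^ 2 * b)) : ℝ) : ℂ) *
        (M r y * G y) := by
    intro b hb
    have hb : 0 < b := hb
    have hbi : ∀ r ∈ R, Integrable fun y : E n =>
        ((b ^ (s + r - l / 2 - 1) * Real.exp (-(‖y‖ ^ 2 * b)) : ℝ) : ℂ) * (M r y * G y) := by
      intro r hr
      obtain ⟨C, hC⟩ := hMb r hr
      have := integrable_mul_schwartz_of_norm_le_rpow (μ := (volume : Measure (E n)))
        (one_le_finrank hn) (p := ((2 * r - l : ℕ) : ℝ)) (C := b ^ (s + r - l / 2 - 1) * C)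
        (by rw [hfr]; have : (0 : ℝ) ≤ ((2 * r - l : ℕ) : ℝ) := Nat.cast_nonneg _
            linarith)
        (u := fun y => ((b ^ (s + r - l / 2 - 1) * Real.exp (-(‖y‖ ^ 2 * b)) : ℝ) : ℂ) * M r y)
        (Continuous.aestronglyMeasurable (by have := hM r hr; fun_prop)) ?_ G
      · simpa only [mul_assoc, Complex.ofReal_mul] using this
      · intro z hz
        rw [norm_mul, Complex.norm_real, Real.norm_of_nonneg (by positivity), Real.rpow_natCast,
          mul_assoc, mul_assoc]
        refine mul_le_mul_of_nonneg_left ?_ (by positivity)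
        refine (mul_le_of_le_one_left (norm_nonneg _) ?_).trans (hC z)
        rw [Real.exp_le_one_iff]
        have : 0 ≤ ‖z‖ ^ 2 * b := by positivity
        linarith
    have e1 : ∀ z : E n,
        ((b ^ (-p - 1) * Real.exp (-(Real.pi ^ 2 * ‖z‖ ^ 2 / b)) : ℝ) : ℂ) * (m z * g z) =
        ((b ^ (-p - 1) : ℝ) : ℂ) *
          (((Real.exp (-(Real.pi ^ 2 * ‖z‖ ^ 2 / b)) : ℝ) : ℂ) * (m z * g z)) := by
      intro z; push_cast; ring
    simp_rw [e1]
    rw [integral_const_mul, h b hb, ← integral_finsetSum _ hbi, ← mul_assoc, mul_left_comm,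
      ← integral_const_mul]
    congr 1
    refine integral_congr_ae (Filter.Eventually.of_forall fun y => ?_)
    simp only [Finset.sum_mul, Finset.mul_sum]
    refine Finset.sum_congr rfl fun r _ => ?_
    have e2 : b ^ (s + r - l / 2 - 1) = b ^ (-p - 1) * b ^ ((n : ℝ) / 2) * b ^ r := by
      rw [← Real.rpow_natCast, ← Real.rpow_add hb, ← Real.rpow_add hb, hp]
      congr 1; ring
    rw [e2]
    push_cast
    ring
  rw [← integral_const_mul]
  have e3 : ∀ z : E n, ((Real.pi ^ (2 * s - l - n) * Real.Gamma p : ℝ) : ℂ) *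
      (((‖z‖ ^ (2 * s - l - n) : ℝ) : ℂ) * (m z * g z)) =
      ((Real.pi ^ (2 * s - l - n) * Real.Gamma p * ‖z‖ ^ (2 * s - l - n) : ℝ) : ℂ) *
        (m z * g z) := by
    intro z; push_cast; ring
  simp_rw [e3]
  rw [← hZ.2, setIntegral_congr_fun measurableSet_Ioi hstep, integral_const_mul,
    integral_finsetSum _ fun r hr => (hY r hr).1]
  congr 1
  simp_rw [Finset.sum_mul, mul_assoc]
  rw [Finset.sum_congr rfl fun r hr => (hY r hr).2, ← integral_finsetSum _ hYint]

/-- The Kronecker symbol. -/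
def kron (j k : Fin n) : ℂ := if j = k then 1 else 0

theorem kron_comm (j k : Fin n) : kron j k = kron k j := by
  simp [kron, eq_comm]

/-- The `j`-th coordinate as a complex number. -/
def coord (j : Fin n) (y : E n) : ℂ := ((y j : ℝ) : ℂ)

theorem coord_eq_inner (j : Fin n) (y : E n) :
    coord j y = ((inner ℝ y (EuclideanSpace.single j (1 : ℝ)) : ℝ) : ℂ) := by
  simp [coord, EuclideanSpace.inner_single_right]

@[fun_prop]
theorem continuous_coord (j : Fin n) : Continuous (coord j) := by
  unfold coord; fun_prop

theorem coord_smul (j : Fin n) (t : ℝ) (y : E n) : coord j (t • y) = t * coord j y := by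
  simp [coord]

@[fun_prop]
theorem hasTemperateGrowth_coord (j : Fin n) : (coord j).HasTemperateGrowth := by
  have h : coord j = fun y : E n => ((inner ℝ y (EuclideanSpace.single j (1 : ℝ)) : ℝ) : ℂ) :=
    funext (coord_eq_inner j)
  rw [h]
  exact Function.Complex.hasTemperateGrowth_ofReal.comp
    (Function.hasTemperateGrowth_inner_left _)

theorem hasLineDerivAt_coord (j k : Fin n) (y : E n) :
    HasLineDerivAt ℝ (coord k) (kron j k) y (EuclideanSpace.single j (1 : ℝ)) := by
  have h : HasDerivAt (fun t : ℝ => coord k y + (t : ℂ) * kron j k) (1 * kron j k) 0 :=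
    (Complex.ofRealCLM.hasDerivAt.mul_const _).const_add _
  rw [one_mul] at h
  refine h.congr_of_eventuallyEq (Filter.Eventually.of_forall fun t => ?_)
  by_cases hjk : j = k
  · subst hjk; simp [coord, kron]
  · simp [coord, kron, hjk, Ne.symm hjk]

/-- The product of an exponential of a negative quadratic, a function of temperate growth and a
Schwartz function is integrable. -/
theorem integrable_gaussian_mul {b : ℝ} (hb : 0 ≤ b) {P : E n → ℂ} (hP : P.HasTemperateGrowth)
    (φ : 𝓢(E n, ℂ)) :
    Integrable fun y => (((Real.exp (-(‖y‖ ^ 2 * b)) : ℝ) : ℂ) * P y) * φ y := by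
  have h := (SchwartzMap.smulLeftCLM ℂ P φ).integrable (μ := volume)
  refine (h.bdd_mul (c := 1) (f := fun y : E n => ((Real.exp (-(‖y‖ ^ 2 * b)) : ℝ) : ℂ))
    (Continuous.aestronglyMeasurable (by fun_prop)) (Filter.Eventually.of_forall fun y => ?_)).congr
    (Filter.Eventually.of_forall fun y => ?_)
  · rw [Complex.norm_real, Real.norm_of_nonneg (by positivity), Real.exp_le_one_iff]
    have : 0 ≤ ‖y‖ ^ 2 * b := by positivity
    linarith
  · simp [hP, mul_assoc]

theorem hasLineDerivAt_gaussian (b : ℝ) (j : Fin n) (y : E n) :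
    HasLineDerivAt ℝ (fun y : E n => ((Real.exp (-(‖y‖ ^ 2 * b)) : ℝ) : ℂ))
      (((Real.exp (-(‖y‖ ^ 2 * b)) : ℝ) : ℂ) * (-2 * b * coord j y)) y
      (EuclideanSpace.single j (1 : ℝ)) := by
  have h1 : HasFDerivAt (fun y : E n => ‖y‖ ^ 2) (2 • (innerSL ℝ y)) y :=
    (hasStrictFDerivAt_norm_sq y).hasFDerivAt
  have h2 := ((h1.mul_const b).neg.exp).hasLineDerivAt (EuclideanSpace.single j (1 : ℝ))
  have h3 := HasDerivAt.ofReal_comp h2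
  refine h3.congr_deriv ?_
  simp [coord, EuclideanSpace.inner_single_right]
  ring

/-- The Gaussian of inverse width `π² / b` times `m` is paired under the Fourier transform with
`κ` times the Gaussian of inverse width `b` times `P`. -/
def GaussianPair (b : ℝ) (m : E n → ℂ) (κ : ℂ) (P : E n → ℂ) : Prop :=
  ∀ g : 𝓢(E n, ℂ), ∫ z, ((Real.exp (-(Real.pi ^ 2 * ‖z‖ ^ 2 / b)) : ℝ) : ℂ) * (m z * g z) =
    κ * ∫ y, (((Real.exp (-(‖y‖ ^ 2 * b)) : ℝ) : ℂ) * P y) * 𝓕 g y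

theorem gaussianPair_one {b : ℝ} (hb : 0 < b) :
    GaussianPair (n := n) b (fun _ => 1) (((b / Real.pi) ^ ((n : ℝ) / 2) : ℝ) : ℂ)
      (fun _ => 1) := by
  intro g
  have hint : Integrable fun y : E n => Complex.exp (-(b : ℂ) * ‖y‖ ^ 2) := by
    simpa using GaussianFourier.integrable_cexp_neg_mul_sq_norm_add (V := E n) (b := (b : ℂ))
      (by simpa using hb) 0 0
  have h := VectorFourier.integral_fourierIntegral_smul_eq_flip (L := innerₗ (E n))
    Real.continuous_fourierChar continuous_inner hint (g.integrable (μ := volume))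
  have h1 : ∀ w : E n, VectorFourier.fourierIntegral Real.fourierChar volume (innerₗ (E n))
      (fun y : E n => Complex.exp (-(b : ℂ) * ‖y‖ ^ 2)) w =
      (((Real.pi / b) ^ ((n : ℝ) / 2) : ℝ) : ℂ) *
        ((Real.exp (-(Real.pi ^ 2 * ‖w‖ ^ 2 / b)) : ℝ) : ℂ) := by
    intro w
    have := fourier_gaussian_innerProductSpace (V := E n) (b := (b : ℂ)) (by simpa using hb) w
    refine Eq.trans this ?_
    rw [Complex.ofReal_cpow (by positivity)]
    push_cast
    simp only [finrank_euclideanSpace, Fintype.card_fin]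
    ring_nf
  have h2 : VectorFourier.fourierIntegral Real.fourierChar volume (innerₗ (E n)).flip
      (g : E n → ℂ) = 𝓕 (g : E n → ℂ) := by
    rw [flip_innerₗ]; rfl
  simp only [h1, h2, smul_eq_mul, mul_assoc] at h
  rw [integral_const_mul] at h
  have h3 : (((b / Real.pi) ^ ((n : ℝ) / 2) : ℝ) : ℂ) *
      (((Real.pi / b) ^ ((n : ℝ) / 2) : ℝ) : ℂ) = 1 := by
    rw [← Complex.ofReal_mul, ← Real.mul_rpow (by positivity) (by positivity)]
    have : b / Real.pi * (Real.pi / b) = 1 := by field_simp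
    rw [this]; simp
  simp only [one_mul, mul_one]
  rw [SchwartzMap.fourier_coe]
  have h4 : ∀ y : E n, ((Real.exp (-(‖y‖ ^ 2 * b)) : ℝ) : ℂ) =
      Complex.exp (-(b : ℂ) * ‖y‖ ^ 2) := by
    intro y; push_cast; ring_nf
  simp only [h4]
  rw [← h, ← mul_assoc, h3, one_mul]

/-- Multiplication by a coordinate on the spatial side is differentiation on the frequency side. -/
theorem GaussianPair.mul_coord {b : ℝ} (hb : 0 ≤ b) {m : E n → ℂ} {κ : ℂ} {P P' Q : E n → ℂ}
    (h : GaussianPair b m κ P) (j : Fin n) (hP : P.HasTemperateGrowth)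
    (hQ : Q.HasTemperateGrowth)
    (hd : ∀ y, HasLineDerivAt ℝ P (P' y) y (EuclideanSpace.single j (1 : ℝ)))
    (hPQ : ∀ y, Q y = P' y - 2 * b * coord j y * P y) :
    GaussianPair b (fun z => m z * coord j z) (κ * (-Complex.I / (2 * Real.pi))) Q := by
  intro g
  set e : E n := EuclideanSpace.single j (1 : ℝ)
  have ht : (fun y : E n => inner ℝ y e).HasTemperateGrowth :=
    Function.hasTemperateGrowth_inner_left e
  set g' : 𝓢(E n, ℂ) := SchwartzMap.smulLeftCLM ℂ (inner ℝ · e) g with hg'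
  have hg'z : ∀ z, g' z = coord j z * g z := by
    intro z
    rw [hg', SchwartzMap.smulLeftCLM_apply_apply ht, coord_eq_inner]
    simp [e]
  set F : 𝓢(E n, ℂ) := 𝓕 g with hFdef
  set DF : 𝓢(E n, ℂ) := LineDeriv.lineDerivOp e F with hDF
  have hF : 𝓕 g' = (Complex.I / (2 * Real.pi)) • DF := by
    rw [hDF, hFdef, SchwartzMap.lineDerivOp_fourier_eq, FourierTransform.fourier_smul, smul_smul, ← hg']
    have : Complex.I / (2 * Real.pi) * -(2 * Real.pi * Complex.I) = 1 := by
      have : (Real.pi : ℂ) ≠ 0 := by exact_mod_cast Real.pi_ne_zero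
      field_simp
      simp
    rw [this, one_smul]
  have h1 := h g'
  have e1 : ∀ z, m z * coord j z * g z = m z * g' z := fun z => by rw [hg'z]; ring
  simp only [e1]
  rw [h1, hF, mul_assoc]
  congr 1
  set γ : E n → ℂ := fun y => ((Real.exp (-(‖y‖ ^ 2 * b)) : ℝ) : ℂ) with hγ
  have hW : ∀ y, HasLineDerivAt ℝ (fun y => γ y * P y) (γ y * Q y) y e := by
    intro y
    have := HasDerivAt.mul (hasLineDerivAt_gaussian b j y) (hd y)
    refine HasDerivAt.congr_deriv this ?_
    simp only [hPQ, zero_smul, add_zero, hγ]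
    ring
  have hG : ∀ y, HasLineDerivAt ℝ F (DF y) y e := by
    intro y
    rw [hDF, SchwartzMap.lineDerivOp_apply_eq_fderiv]
    exact (F.hasFDerivAt y).hasLineDerivAt e
  have hparts := integral_bilinear_hasLineDerivAt_right_eq_neg_left_of_integrable
    (B := ContinuousLinearMap.mul ℝ ℂ) (μ := volume) (v := e)
    (f := fun y => γ y * P y) (f' := fun y => γ y * Q y) (g := F)
    (g' := DF)
    (integrable_gaussian_mul hb hQ F) (integrable_gaussian_mul hb hP DF)
    (integrable_gaussian_mul hb hP F) (fun y _ => hW y) (fun y _ => hG y)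
  simp only [ContinuousLinearMap.mul_apply'] at hparts
  have e2 : ∀ y, γ y * P y * ((Complex.I / (2 * Real.pi)) • DF) y =
      Complex.I / (2 * Real.pi) * (γ y * P y * DF y) := by
    intro y; simp only [smul_apply, smul_eq_mul]; ring
  rw [integral_congr_ae (Filter.Eventually.of_forall e2), integral_const_mul, hparts]
  ring

/-- A continuous function that is positively homogeneous of degree `d` is bounded by a multiple of
`‖y‖ ^ d`. -/
theorem exists_norm_le_of_homogeneous (hn : 1 ≤ n) {M : E n → ℂ} (hM : Continuous M) {d : ℕ}
    (hd : ∀ (t : ℝ) (y : E n), M (t • y) = (t : ℂ) ^ d * M y) :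
    ∃ C, ∀ y, ‖M y‖ ≤ C * ‖y‖ ^ d := by
  have hV : Nontrivial (E n) := Module.nontrivial_of_finrank_pos (R := ℝ) (one_le_finrank hn)
  obtain ⟨C, hC⟩ := (isCompact_sphere (0 : E n) 1).exists_bound_of_continuousOn hM.continuousOn
  refine ⟨C, fun y => ?_⟩
  obtain ⟨u, hu, hy⟩ : ∃ u : E n, ‖u‖ = 1 ∧ y = ‖y‖ • u := by
    by_cases hy : y = 0
    · obtain ⟨u, hu⟩ := exists_norm_eq (E n) zero_le_one
      exact ⟨u, hu, by simp [hy]⟩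
    · have : ‖y‖ ≠ 0 := norm_ne_zero_iff.2 hy
      exact ⟨‖y‖⁻¹ • y, by simp [norm_smul, this], by simp [smul_smul, this]⟩
  have h1 : ‖M u‖ ≤ C := hC u (by simpa using hu)
  calc ‖M y‖ = ‖y‖ ^ d * ‖M u‖ := by
        conv_lhs => rw [hy, hd]
        simp
    _ ≤ ‖y‖ ^ d * C := by gcongr
    _ = _ := mul_comm _ _

theorem avgConst_mul_eq (hn : 2 ≤ n) {s : ℝ} (hs : s ∈ Ioo (0 : ℝ) 1) (k : ℕ) {I Y : ℂ}
    (h : ((Real.pi ^ (2 * s - (2 + k : ℕ) - n) *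
        Real.Gamma ((n + (2 + k : ℕ) - 2 * s) / 2) : ℝ) : ℂ) * I =
      ((Real.pi ^ (-((n : ℝ) / 2)) : ℝ) : ℂ) * (-Complex.I / (2 * Real.pi)) ^ (2 + k) * Y) :
    (avgConst n s 2 k : ℂ) * I =
      -(-Complex.I) ^ (2 + k) * 2 ^ ((2 + k) / 2) / 2 ^ (2 + k) *
        (((2 * Real.pi) ^ (-(2 * s)) / Real.Gamma (s + ((2 + k) % 2 : ℕ) / 2) : ℝ) : ℂ) * Y := by
  have hn' : (2 : ℝ) ≤ n := by exact_mod_cast hn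
  have hk : (0 : ℝ) ≤ k := Nat.cast_nonneg k
  obtain ⟨hs0, hs1⟩ := hs
  have hpi := Real.pi_pos
  set G := Real.Gamma ((n + (2 + k : ℕ) - 2 * s) / 2) with hG
  set G' := Real.Gamma (s + ((2 + k) % 2 : ℕ) / 2) with hG'
  have hGpos : 0 < G := Real.Gamma_pos_of_pos (by push_cast; linarith)
  have hG'pos : 0 < G' := Real.Gamma_pos_of_pos (by positivity)
  have hX : (Real.pi ^ (2 * s - (2 + k : ℕ) - n) : ℝ) ≠ 0 := by positivity
  have hXc : ((Real.pi ^ (2 * s - (2 + k : ℕ) - n) : ℝ) : ℂ) ≠ 0 := by exact_mod_cast hX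
  have hGc : (G : ℂ) ≠ 0 := by exact_mod_cast hGpos.ne'
  have hG'c : (G' : ℂ) ≠ 0 := by exact_mod_cast hG'pos.ne'
  have hpic : (Real.pi : ℂ) ≠ 0 := by exact_mod_cast hpi.ne'
  have hI : I = ((Real.pi ^ (2 * s - (2 + k : ℕ) - n) * G : ℝ) : ℂ)⁻¹ *
      (((Real.pi ^ (-((n : ℝ) / 2)) : ℝ) : ℂ) * (-Complex.I / (2 * Real.pi)) ^ (2 + k) * Y) := by
    rw [← h, ← mul_assoc, inv_mul_cancel₀ (by rw [Complex.ofReal_mul]; exact mul_ne_zero hXc hGc), one_mul]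
  have hc : avgConst n s 2 k = -G / ((2 : ℝ) ^ (2 * s - ((2 + k) / 2 : ℕ)) *
      Real.pi ^ ((n : ℝ) / 2) * G') := by
    unfold avgConst
    rw [hG, hG']
    push_cast
    ring_nf
  have hreal : -G / ((2 : ℝ) ^ (2 * s - ((2 + k) / 2 : ℕ)) * Real.pi ^ ((n : ℝ) / 2) * G') *
      (Real.pi ^ (2 * s - (2 + k : ℕ) - n) * G)⁻¹ * Real.pi ^ (-((n : ℝ) / 2)) =
      -(2 : ℝ) ^ ((2 + k) / 2) * Real.pi ^ (2 + k) * ((2 * Real.pi) ^ (-(2 * s)) / G') := by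
    have e1 : (2 : ℝ) ^ (2 * s - ((2 + k) / 2 : ℕ)) = (2 : ℝ) ^ (2 * s) / 2 ^ ((2 + k) / 2) := by
      rw [Real.rpow_sub two_pos, Real.rpow_natCast]
    have e2 : Real.pi ^ (2 * s - (2 + k : ℕ) - n) = Real.pi ^ (2 * s) / Real.pi ^ (2 + k) /
        (Real.pi ^ ((n : ℝ) / 2) * Real.pi ^ ((n : ℝ) / 2)) := by
      rw [Real.rpow_sub hpi, Real.rpow_sub hpi, Real.rpow_natCast, ← Real.rpow_add hpi, add_halves]
    rw [e1, e2, Real.rpow_neg hpi.le, Real.rpow_neg (by positivity),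
      Real.mul_rpow two_pos.le hpi.le]
    field_simp
  rw [hI, hc]
  have hrc := congrArg (fun x : ℝ => (x : ℂ)) hreal
  simp only [Complex.ofReal_mul] at hrc
  rw [show ∀ a b c d e : ℂ, a * (b * (c * d * e)) = (a * b * c) * d * e by intros; ring]
  rw [Complex.ofReal_inv] at hrc
  rw [hrc, div_pow, mul_pow]
  push_cast
  field_simp

/-- The frequency side of a family of Gaussian pairs, integrated over the widths. -/
theorem avgConst_mul_integral_of_gaussianPair (hn : 2 ≤ n) {s : ℝ} (hs : s ∈ Ioo (0 : ℝ) 1) (k : ℕ)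
    {m : E n → ℂ} (hm : Continuous m)
    (hmh : ∀ (t : ℝ) (y : E n), m (t • y) = (t : ℂ) ^ (2 + k) * m y)
    {R : Finset ℕ} (hR : ∀ r ∈ R, 2 + k ≤ 2 * r) {M : ℕ → E n → ℂ} (hM : ∀ r ∈ R, Continuous (M r))
    (hMh : ∀ r ∈ R, ∀ (t : ℝ) (y : E n), M r (t • y) = (t : ℂ) ^ (2 * r - (2 + k)) * M r y)
    (h : ∀ b : ℝ, 0 < b → GaussianPair b m
      ((((b / Real.pi) ^ ((n : ℝ) / 2) : ℝ) : ℂ) * (-Complex.I / (2 * Real.pi)) ^ (2 + k))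
      (fun y => ∑ r ∈ R, (b : ℂ) ^ r * M r y))
    {S : E n → ℂ} (hS : ∀ y, y ≠ 0 →
      -(-Complex.I) ^ (2 + k) * 2 ^ ((2 + k) / 2) / 2 ^ (2 + k) *
        (((2 * Real.pi) ^ (-(2 * s)) / Real.Gamma (s + ((2 + k) % 2 : ℕ) / 2) : ℝ) : ℂ) *
        (∑ r ∈ R, ((Real.Gamma (s + r - (2 + k : ℕ) / 2) *
          ‖y‖ ^ (((2 + k : ℕ) : ℝ) - 2 * r - 2 * s) : ℝ) : ℂ) * M r y) = S y)
    (g : 𝓢(E n, ℂ)) :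
    (avgConst n s 2 k : ℂ) * ∫ z, ((‖z‖ ^ (2 * s - (2 + k : ℕ) - n) : ℝ) : ℂ) * (m z * g z) =
      ∫ y, S y * 𝓕 g y := by
  have hn1 : 1 ≤ n := by omega
  have hV : Nontrivial (E n) := Module.nontrivial_of_finrank_pos (R := ℝ) (one_le_finrank hn1)
  have hne : ∀ᵐ z : E n, z ≠ 0 := by simp [ae_iff]
  have hn' : (2 : ℝ) ≤ n := by exact_mod_cast hn
  obtain ⟨Cm, hCm⟩ := exists_norm_le_of_homogeneous hn1 hm hmh
  have h1 := integral_homogeneous_kernel hn1 hs.1 (by linarith [hs.2]) (2 + k) hm hCm hR hM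
    (fun r hr => exists_norm_le_of_homogeneous hn1 (hM r hr) (hMh r hr))
    (κ := ((Real.pi ^ (-((n : ℝ) / 2)) : ℝ) : ℂ) * (-Complex.I / (2 * Real.pi)) ^ (2 + k))
    (g := g) (G := 𝓕 g) (fun b hb => by
      rw [h b hb g, Real.div_rpow hb.le Real.pi_pos.le, Real.rpow_neg Real.pi_pos.le]
      simp only [mul_assoc]
      push_cast
      ring)
  rw [avgConst_mul_eq hn hs k h1, ← integral_const_mul]
  refine integral_congr_ae (hne.mono fun y hy => ?_)
  simp only
  rw [← hS y hy]
  ring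

section GaussianDerivatives

variable {b : ℝ}

theorem gaussianPair_coord (hb : 0 < b) (j : Fin n) :
    GaussianPair b (coord j)
      ((((b / Real.pi) ^ ((n : ℝ) / 2) : ℝ) : ℂ) * (-Complex.I / (2 * Real.pi)))
      (fun y => -2 * b * coord j y) := by
  have h := (gaussianPair_one (n := n) hb).mul_coord hb.le j (P' := fun _ => 0)
    (Q := fun y => -2 * b * coord j y) (by fun_prop) (by fun_prop)
    (fun y => hasDerivAt_const _ _) (fun y => by ring)
  simpa only [one_mul] using h

theorem gaussianPair_coord_two (hb : 0 < b) (j k : Fin n) :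
    GaussianPair b (fun z => coord j z * coord k z)
      ((((b / Real.pi) ^ ((n : ℝ) / 2) : ℝ) : ℂ) * (-Complex.I / (2 * Real.pi)) ^ 2)
      (fun y => b * (-2 * kron j k) + b ^ 2 * (4 * (coord j y * coord k y))) := by
  have h := (gaussianPair_coord (n := n) hb j).mul_coord hb.le k
    (P' := fun y => -2 * b * kron k j)
    (Q := fun y => b * (-2 * kron j k) + b ^ 2 * (4 * (coord j y * coord k y)))
    (by fun_prop) (by fun_prop)
    (fun y => (hasLineDerivAt_coord k j y).const_mul _)
    (fun y => by rw [kron_comm k j]; ring)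
  rwa [mul_assoc, ← pow_two] at h

theorem gaussianPair_coord_three (hb : 0 < b) (i j k : Fin n) :
    GaussianPair b (fun z => coord i z * coord j z * coord k z)
      ((((b / Real.pi) ^ ((n : ℝ) / 2) : ℝ) : ℂ) * (-Complex.I / (2 * Real.pi)) ^ 3)
      (fun y => b ^ 2 * (4 * (kron j k * coord i y + kron i k * coord j y + kron i j * coord k y))
        + b ^ 3 * (-8 * (coord i y * coord j y * coord k y))) := by
  have h := (gaussianPair_coord_two (n := n) hb i j).mul_coord hb.le k
    (P' := fun y => b ^ 2 * (4 * (kron k i * coord j y + coord i y * kron k j)))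
    (Q := fun y => b ^ 2 * (4 * (kron j k * coord i y + kron i k * coord j y + kron i j * coord k y))
        + b ^ 3 * (-8 * (coord i y * coord j y * coord k y)))
    (by fun_prop) (by fun_prop)
    (fun y => by
      refine HasDerivAt.congr_deriv ((((HasDerivAt.mul (hasLineDerivAt_coord k i y)
        (hasLineDerivAt_coord k j y)).const_mul 4).const_mul ((b : ℂ) ^ 2)).const_add _) ?_
      simp)
    (fun y => by rw [kron_comm k i, kron_comm k j]; ring)
  rwa [mul_assoc, ← pow_succ] at h

theorem gaussianPair_coord_four (hb : 0 < b) (i j k l : Fin n) :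
    GaussianPair b (fun z => coord i z * coord j z * coord k z * coord l z)
      ((((b / Real.pi) ^ ((n : ℝ) / 2) : ℝ) : ℂ) * (-Complex.I / (2 * Real.pi)) ^ 4)
      (fun y => b ^ 2 * (4 * (kron i j * kron k l + kron i k * kron j l + kron i l * kron j k))
        + b ^ 3 * (-8 * (kron i j * (coord k y * coord l y) + kron i k * (coord j y * coord l y)
          + kron i l * (coord j y * coord k y) + kron j k * (coord i y * coord l y)
          + kron j l * (coord i y * coord k y) + kron k l * (coord i y * coord j y)))
        + b ^ 4 * (16 * (coord i y * coord j y * coord k y * coord l y))) := by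
  have h := (gaussianPair_coord_three (n := n) hb i j k).mul_coord hb.le l
    (P' := fun y => b ^ 2 * (4 * (kron j k * kron l i + kron i k * kron l j + kron i j * kron l k))
      + b ^ 3 * (-8 * ((kron l i * coord j y + coord i y * kron l j) * coord k y
        + coord i y * coord j y * kron l k)))
    (Q := fun y => b ^ 2 * (4 * (kron i j * kron k l + kron i k * kron j l + kron i l * kron j k))
        + b ^ 3 * (-8 * (kron i j * (coord k y * coord l y) + kron i k * (coord j y * coord l y)
          + kron i l * (coord j y * coord k y) + kron j k * (coord i y * coord l y)
          + kron j l * (coord i y * coord k y) + kron k l * (coord i y * coord j y)))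
        + b ^ 4 * (16 * (coord i y * coord j y * coord k y * coord l y)))
    (by fun_prop) (by fun_prop)
    (fun y => by
      have hi := hasLineDerivAt_coord l i y
      have hj := hasLineDerivAt_coord l j y
      have hk := hasLineDerivAt_coord l k y
      refine HasDerivAt.congr_deriv (HasDerivAt.add
        (((HasDerivAt.add (HasDerivAt.add (HasDerivAt.const_mul (kron j k) hi)
          (HasDerivAt.const_mul (kron i k) hj))
          (HasDerivAt.const_mul (kron i j) hk)).const_mul 4).const_mul ((b : ℂ) ^ 2))
        (((HasDerivAt.mul (HasDerivAt.mul hi hj) hk).const_mul (-8)).const_mul ((b : ℂ) ^ 3))) ?_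
      simp)
    (fun y => by rw [kron_comm l i, kron_comm l j, kron_comm l k]; ring)
  rwa [mul_assoc, ← pow_succ] at h

end GaussianDerivatives

/-- The `j`-th component of the direction `y / |y|`. -/
def dir (j : Fin n) (y : E n) : ℂ := coord j y / (‖y‖ : ℂ)

/-- The symbol `|2πy|^{-2s}`. -/
def rieszPotentialSymbol (s : ℝ) (y : E n) : ℂ := (((2 * Real.pi * ‖y‖) ^ (-(2 * s)) : ℝ) : ℂ)

theorem rieszPotentialSymbol_eq (s : ℝ) (y : E n) : rieszPotentialSymbol s y =
    (((2 * Real.pi) ^ (-(2 * s)) : ℝ) : ℂ) * ((‖y‖ ^ (-(2 * s)) : ℝ) : ℂ) := by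
  rw [rieszPotentialSymbol, Real.mul_rpow (by positivity) (norm_nonneg _), Complex.ofReal_mul]

/-- The Fourier symbol of the normalized kernel `z_j z_k |z|^{2s-n-2}`. -/
def symbolTwo (s : ℝ) (j k : Fin n) (y : E n) : ℂ :=
  -rieszPotentialSymbol s y * (kron j k - 2 * s * (dir j y * dir k y))

/-- The Fourier symbol of the normalized kernel `z_i z_j z_k |z|^{2s-n-3}`. -/
def symbolThree (s : ℝ) (i j k : Fin n) (y : E n) : ℂ :=
  -Complex.I * rieszPotentialSymbol s y *
    (kron j k * dir i y + kron i k * dir j y + kron i j * dir k y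
      - (2 * s + 1) * (dir i y * dir j y * dir k y))

/-- The Fourier symbol of the normalized kernel `z_i z_j z_k z_l |z|^{2s-n-4}`. -/
def symbolFour (s : ℝ) (i j k l : Fin n) (y : E n) : ℂ :=
  -rieszPotentialSymbol s y *
    (kron i j * kron k l + kron i k * kron j l + kron i l * kron j k
      - 2 * s * (kron i j * (dir k y * dir l y) + kron i k * (dir j y * dir l y)
          + kron i l * (dir j y * dir k y) + kron j k * (dir i y * dir l y)
          + kron j l * (dir i y * dir k y) + kron k l * (dir i y * dir j y))
      + 4 * s * (s + 1) * (dir i y * dir j y * dir k y * dir l y))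

theorem rpow_norm_sub_nat {y : E n} (hy : y ≠ 0) (s : ℝ) {l r d : ℕ} (h : 2 * r = l + d) :
    ‖y‖ ^ ((l : ℝ) - 2 * r - 2 * s) = ‖y‖ ^ (-(2 * s)) / ‖y‖ ^ d := by
  have h' : (2 * r : ℝ) = l + d := by exact_mod_cast h
  rw [← Real.rpow_natCast, ← Real.rpow_sub (norm_pos_iff.2 hy), h']
  ring_nf

theorem avgConst_mul_integral_two (hn : 2 ≤ n) {s : ℝ} (hs : s ∈ Ioo (0 : ℝ) 1) (j k : Fin n)
    (g : 𝓢(E n, ℂ)) :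
    (avgConst n s 2 0 : ℂ) * ∫ z, ((‖z‖ ^ (2 * s - (2 + 0 : ℕ) - n) : ℝ) : ℂ) *
      (coord j z * coord k z * g z) = ∫ y, symbolTwo s j k y * 𝓕 g y := by
  refine avgConst_mul_integral_of_gaussianPair hn hs 0
    (m := fun z => coord j z * coord k z) (by fun_prop)
    (fun t y => by simp only [coord_smul]; ring) (R := {1, 2}) (by simp)
    (M := fun r y => if r = 1 then -2 * kron j k else 4 * (coord j y * coord k y))
    (by intro r hr; split_ifs <;> fun_prop) ?_ ?_ ?_ g
  · simp only [Finset.mem_insert, Finset.mem_singleton, coord_smul]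
    rintro r (rfl | rfl) t y <;> (simp; try ring)
  · intro b hb
    simpa using gaussianPair_coord_two hb j k
  · intro y hy
    have hy' : (‖y‖ : ℂ) ≠ 0 := by exact_mod_cast norm_ne_zero_iff.2 hy
    have hΓ : Real.Gamma s ≠ 0 := (Real.Gamma_pos_of_pos hs.1).ne'
    have hΓ' : (Real.Gamma s : ℂ) ≠ 0 := by exact_mod_cast hΓ
    have g1 : Real.Gamma (s + 1) = s * Real.Gamma s := Real.Gamma_add_one hs.1.ne'
    rw [Finset.sum_pair (by norm_num), symbolTwo, rieszPotentialSymbol_eq,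
      rpow_norm_sub_nat hy s (l := 2 + 0) (r := 1) (d := 0) rfl, rpow_norm_sub_nat hy s (l := 2 + 0) (r := 2) (d := 2) rfl]
    have a0 : s + ((2 + 0) % 2 : ℕ) / 2 = s := by norm_num
    have a1 : s + (1 : ℕ) - ((2 + 0 : ℕ) : ℝ) / 2 = s := by push_cast; ring
    have a2 : s + (2 : ℕ) - ((2 + 0 : ℕ) : ℝ) / 2 = s + 1 := by push_cast; ring
    rw [a0, a1, a2, g1]
    simp only [dir, if_true, OfNat.ofNat_ne_one, if_false]
    push_cast
    field_simp
    simp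
    ring

theorem avgConst_mul_integral_three (hn : 2 ≤ n) {s : ℝ} (hs : s ∈ Ioo (0 : ℝ) 1) (i j k : Fin n)
    (g : 𝓢(E n, ℂ)) :
    (avgConst n s 2 1 : ℂ) * ∫ z, ((‖z‖ ^ (2 * s - (2 + 1 : ℕ) - n) : ℝ) : ℂ) *
      (coord i z * coord j z * coord k z * g z) = ∫ y, symbolThree s i j k y * 𝓕 g y := by
  refine avgConst_mul_integral_of_gaussianPair hn hs 1
    (m := fun z => coord i z * coord j z * coord k z) (by fun_prop)
    (fun t y => by simp only [coord_smul]; ring) (R := {2, 3}) (by simp)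
    (M := fun r y => if r = 2 then
      4 * (kron j k * coord i y + kron i k * coord j y + kron i j * coord k y)
      else -8 * (coord i y * coord j y * coord k y))
    (by intro r hr; split_ifs <;> fun_prop) ?_ ?_ ?_ g
  · simp only [Finset.mem_insert, Finset.mem_singleton, coord_smul]
    rintro r (rfl | rfl) t y <;> simp <;> ring
  · intro b hb
    simpa using gaussianPair_coord_three hb i j k
  · intro y hy
    have hy' : (‖y‖ : ℂ) ≠ 0 := by exact_mod_cast norm_ne_zero_iff.2 hy
    have hs2 : 0 < s + 1 / 2 := by linarith [hs.1]
    have hΓ : Real.Gamma (s + 1 / 2) ≠ 0 := (Real.Gamma_pos_of_pos hs2).ne'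
    have hΓ' : (Real.Gamma (s + 1 / 2) : ℂ) ≠ 0 := by exact_mod_cast hΓ
    have g1 : Real.Gamma (s + 1 / 2 + 1) = (s + 1 / 2) * Real.Gamma (s + 1 / 2) :=
      Real.Gamma_add_one hs2.ne'
    rw [Finset.sum_pair (by norm_num), symbolThree, rieszPotentialSymbol_eq,
      rpow_norm_sub_nat hy s (l := 2 + 1) (r := 2) (d := 1) rfl, rpow_norm_sub_nat hy s (l := 2 + 1) (r := 3) (d := 3) rfl]
    have a0 : s + ((2 + 1) % 2 : ℕ) / 2 = s + 1 / 2 := by norm_num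
    have a1 : s + (2 : ℕ) - ((2 + 1 : ℕ) : ℝ) / 2 = s + 1 / 2 := by push_cast; ring
    have a2 : s + (3 : ℕ) - ((2 + 1 : ℕ) : ℝ) / 2 = s + 1 / 2 + 1 := by push_cast; ring
    rw [a0, a1, a2, g1]
    have hI : (-Complex.I) ^ (2 + 1) = Complex.I := by
      rw [pow_succ, neg_sq, Complex.I_sq]; ring
    rw [hI]
    simp only [dir, if_true, Nat.reduceEqDiff, if_false]
    generalize Real.Gamma (s + 1 / 2) = Γ at *
    push_cast
    field_simp
    norm_num
    ring

theorem avgConst_mul_integral_four (hn : 2 ≤ n) {s : ℝ} (hs : s ∈ Ioo (0 : ℝ) 1)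
    (i j k l : Fin n) (g : 𝓢(E n, ℂ)) :
    (avgConst n s 2 2 : ℂ) * ∫ z, ((‖z‖ ^ (2 * s - (2 + 2 : ℕ) - n) : ℝ) : ℂ) *
      (coord i z * coord j z * coord k z * coord l z * g z) =
      ∫ y, symbolFour s i j k l y * 𝓕 g y := by
  refine avgConst_mul_integral_of_gaussianPair hn hs 2
    (m := fun z => coord i z * coord j z * coord k z * coord l z) (by fun_prop)
    (fun t y => by simp only [coord_smul]; ring) (R := {2, 3, 4}) (by simp)
    (M := fun r y => if r = 2 then
      4 * (kron i j * kron k l + kron i k * kron j l + kron i l * kron j k)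
      else if r = 3 then
      -8 * (kron i j * (coord k y * coord l y) + kron i k * (coord j y * coord l y)
          + kron i l * (coord j y * coord k y) + kron j k * (coord i y * coord l y)
          + kron j l * (coord i y * coord k y) + kron k l * (coord i y * coord j y))
      else 16 * (coord i y * coord j y * coord k y * coord l y))
    (by intro r hr; split_ifs <;> fun_prop) ?_ ?_ ?_ g
  · simp only [Finset.mem_insert, Finset.mem_singleton, coord_smul]
    rintro r (rfl | rfl | rfl) t y <;> simp <;> ring
  · intro b hb
    simpa [add_assoc] using gaussianPair_coord_four hb i j k l
  · intro y hy
    have hy' : (‖y‖ : ℂ) ≠ 0 := by exact_mod_cast norm_ne_zero_iff.2 hy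
    have hΓ : Real.Gamma s ≠ 0 := (Real.Gamma_pos_of_pos hs.1).ne'
    have hΓ' : (Real.Gamma s : ℂ) ≠ 0 := by exact_mod_cast hΓ
    have g1 : Real.Gamma (s + 1) = s * Real.Gamma s := Real.Gamma_add_one hs.1.ne'
    have g2 : Real.Gamma (s + 2) = (s + 1) * (s * Real.Gamma s) := by
      rw [← g1, ← Real.Gamma_add_one (by linarith [hs.1])]
      ring_nf
    rw [Finset.sum_insert (by norm_num), Finset.sum_pair (by norm_num), symbolFour,
      rieszPotentialSymbol_eq,
      rpow_norm_sub_nat hy s (l := 2 + 2) (r := 2) (d := 0) rfl, rpow_norm_sub_nat hy s (l := 2 + 2) (r := 3) (d := 2) rfl,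
      rpow_norm_sub_nat hy s (l := 2 + 2) (r := 4) (d := 4) rfl]
    have a0 : s + ((2 + 2) % 2 : ℕ) / 2 = s := by norm_num
    have a1 : s + (2 : ℕ) - ((2 + 2 : ℕ) : ℝ) / 2 = s := by push_cast; ring
    have a2 : s + (3 : ℕ) - ((2 + 2 : ℕ) : ℝ) / 2 = s + 1 := by push_cast; ring
    have a3 : s + (4 : ℕ) - ((2 + 2 : ℕ) : ℝ) / 2 = s + 2 := by push_cast; ring
    rw [a0, a1, a2, a3, g1, g2]
    simp only [dir, if_true, Nat.reduceEqDiff, if_false]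
    have hI : (-Complex.I) ^ (2 + 2) = 1 := by
      rw [pow_add, neg_sq, Complex.I_sq]; ring
    rw [hI]
    push_cast
    field_simp
    norm_num
    ring

theorem integral_volumeIoiPow (d : ℕ) (h : ℝ → ℂ) :
    ∫ r : Ioi (0 : ℝ), h r ∂(Measure.volumeIoiPow d) =
      ∫ t in Ioi (0 : ℝ), ((t ^ d : ℝ) : ℂ) * h t := by
  simp only [Measure.volumeIoiPow, ENNReal.ofReal]
  rw [integral_withDensity_eq_integral_smul,
    integral_subtype_comap measurableSet_Ioi fun a ↦ Real.toNNReal (a ^ d) • h a,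
    setIntegral_congr_fun measurableSet_Ioi fun x hx ↦ ?_]
  · simp only [NNReal.smul_def, Real.coe_toNNReal _ (pow_nonneg hx.out.le _), Complex.real_smul]
  · exact (measurable_subtype_coe.pow_const _).real_toNNReal

/-- Integration in polar coordinates. -/
theorem integral_polar {φ : E n → ℂ} (hφ : Integrable φ) :
    Integrable (fun ξ : Metric.sphere (0 : E n) 1 =>
      ∫ t in Ioi (0 : ℝ), ((t ^ (n - 1) : ℝ) : ℂ) * φ (t • (ξ : E n)))
      (volume : Measure (E n)).toSphere ∧
    ∫ ξ : Metric.sphere (0 : E n) 1,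
      (∫ t in Ioi (0 : ℝ), ((t ^ (n - 1) : ℝ) : ℂ) * φ (t • (ξ : E n)))
      ∂(volume : Measure (E n)).toSphere = ∫ z in {0}ᶜ, φ z := by
  have hmp := (volume : Measure (E n)).measurePreserving_homeomorphUnitSphereProd
  have hemb := (homeomorphUnitSphereProd (E n)).measurableEmbedding
  set ψ : Metric.sphere (0 : E n) 1 × Ioi (0 : ℝ) → ℂ := fun p => φ ((p.2 : ℝ) • (p.1 : E n))
  have hψ : ∀ x : ({0}ᶜ : Set (E n)), ψ (homeomorphUnitSphereProd (E n) x) = φ x := by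
    intro x
    have hx : ‖(x : E n)‖ ≠ 0 := norm_ne_zero_iff.2 x.2
    simp [ψ, smul_smul, hx]
  have hfr : Module.finrank ℝ (E n) = n := by simp
  rw [hfr] at hmp
  have hint : Integrable ψ ((volume : Measure (E n)).toSphere.prod (.volumeIoiPow (n - 1))) := by
    rw [← hmp.integrable_comp_emb hemb]
    have h1 : ψ ∘ homeomorphUnitSphereProd (E n) = φ ∘ Subtype.val := funext hψ
    rw [h1, ← integrableOn_iff_comap_subtypeVal (measurableSet_singleton _).compl]
    exact hφ.integrableOn
  have e1 : ∀ ξ : Metric.sphere (0 : E n) 1,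
      ∫ r, ψ (ξ, r) ∂(Measure.volumeIoiPow (n - 1)) =
      ∫ t in Ioi (0 : ℝ), ((t ^ (n - 1) : ℝ) : ℂ) * φ (t • (ξ : E n)) := fun ξ =>
    integral_volumeIoiPow (n - 1) fun t => φ (t • (ξ : E n))
  refine ⟨by simpa only [e1] using hint.integral_prod_left, ?_⟩
  simp only [← e1]
  rw [← integral_prod _ hint, ← hmp.integral_comp hemb,
    ← integral_subtype_comap (measurableSet_singleton _).compl]
  exact integral_congr_ae (Filter.Eventually.of_forall hψ)

/-- Restriction of a Schwartz function to a line. -/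
theorem exists_schwartz_line (g : 𝓢(E n, ℂ)) (x : E n) {ξ : E n} (hξ : ‖ξ‖ = 1) :
    ∃ h : 𝓢(ℝ, ℂ), ∀ t, h t = g (x + t • ξ) := by
  refine ⟨SchwartzMap.compCLMOfAntilipschitz ℂ (K := 1) (g := fun t : ℝ => x + t • ξ)
    (by fun_prop) (fun a b => ?_) g, fun t => rfl⟩
  simp [edist_dist, dist_eq_norm, ← sub_smul, norm_smul, hξ]

theorem integrableOn_beamIntegrand {m : ℕ} {s : ℝ} (hs : 0 < s) (f : SymTensorField n m) (x : E n)
    {ξ : E n} (hξ : ‖ξ‖ = 1) : IntegrableOn (beamIntegrand s f x ξ) (Ioi 0) := by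
  refine Integrable.integrableOn ?_
  unfold beamIntegrand
  simp only [Finset.mul_sum]
  refine integrable_finsetSum _ fun J _ => ?_
  obtain ⟨h, hh⟩ := exists_schwartz_line (f.comp J) x hξ
  have := integrable_mul_schwartz_of_norm_le_rpow (μ := (volume : Measure ℝ)) (by simp)
    (p := 2 * s - 1) (C := 1) (by simp; linarith) (u := fun t : ℝ => ((t ^ (2 * s - 1) : ℝ) : ℂ))
    (Complex.measurable_ofReal.comp (measurable_id.pow_const _)).aestronglyMeasurable
    (fun t _ => by
      rw [Complex.norm_real, one_mul]
      exact Real.abs_rpow_le_abs_rpow t _) h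
  refine (this.mul_const (∏ a, ((ξ (J a) : ℝ) : ℂ))).congr (Filter.Eventually.of_forall fun t => ?_)
  simp only [hh]
  ring

/-- The average of the beam transform is a sum of convolutions with homogeneous kernels. -/
theorem average_eq_sum (hn : 2 ≤ n) {s : ℝ} (hs : s ∈ Ioo (0 : ℝ) 1) (f : SymTensorField n 2)
    (I : Fin k → Fin n) (x : E n) :
    Integrable (averageIntegrand s f I x) (volume : Measure (E n)).toSphere ∧
    average s f I x = ∑ J, (avgConst n s 2 k : ℂ) *
      ∫ z, ((‖z‖ ^ (2 * s - (2 + k : ℕ) - n) : ℝ) : ℂ) *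
        ((∏ a, coord (I a) z) * (∏ a, coord (J a) z) * f.comp J (x + z)) := by
  have hn1 : 1 ≤ n := by omega
  have hV : Nontrivial (E n) := Module.nontrivial_of_finrank_pos (R := ℝ) (one_le_finrank hn1)
  have hn' : (2 : ℝ) ≤ n := by exact_mod_cast hn
  set φ : (Fin 2 → Fin n) → E n → ℂ := fun J z => ((‖z‖ ^ (2 * s - (2 + k : ℕ) - n) : ℝ) : ℂ) *
        ((∏ a, coord (I a) z) * (∏ a, coord (J a) z) * f.comp J (x + z)) with hφ
  have hcoord : ∀ (j : Fin n) (z : E n), ‖coord j z‖ ≤ ‖z‖ := fun j z => by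
    rw [coord, Complex.norm_real]; exact PiLp.norm_apply_le z j
  have hint : ∀ J, Integrable (φ J) := by
    intro J
    have := integrable_mul_schwartz_of_norm_le_rpow (μ := (volume : Measure (E n)))
      (one_le_finrank hn1) (p := 2 * s - n) (C := 1)
      (by simp; linarith [hs.1])
      (u := fun z => ((‖z‖ ^ (2 * s - (2 + k : ℕ) - n) : ℝ) : ℂ) *
        ((∏ a, coord (I a) z) * (∏ a, coord (J a) z)))
      ((Complex.measurable_ofReal.comp (measurable_norm.pow_const _)).aestronglyMeasurable.mul
        (Continuous.aestronglyMeasurable (by fun_prop))) ?_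
      ((f.comp J).compSubConstCLM ℂ (-x))
    · refine this.congr (Filter.Eventually.of_forall fun z => ?_)
      simp only [hφ, SchwartzMap.compSubConstCLM_apply, sub_neg_eq_add, add_comm z x, mul_assoc]
    · intro z hz
      have hz : 0 < ‖z‖ := norm_pos_iff.2 hz
      rw [norm_mul, norm_mul, Complex.norm_real, Real.norm_of_nonneg (by positivity), norm_prod,
        norm_prod]
      have h1 : ∏ a, ‖coord (I a) z‖ ≤ ‖z‖ ^ k :=
        (Finset.prod_le_prod (fun _ _ => norm_nonneg _) fun a _ => hcoord (I a) z).trans (by simp)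
      have h2 : ∏ a, ‖coord (J a) z‖ ≤ ‖z‖ ^ 2 :=
        (Finset.prod_le_prod (fun _ _ => norm_nonneg _) fun a _ => hcoord (J a) z).trans (by simp)
      calc ‖z‖ ^ (2 * s - (2 + k : ℕ) - n) * ((∏ a, ‖coord (I a) z‖) * ∏ a, ‖coord (J a) z‖)
          ≤ ‖z‖ ^ (2 * s - (2 + k : ℕ) - n) * (‖z‖ ^ k * ‖z‖ ^ 2) := by gcongr
        _ = ‖z‖ ^ (2 * s - (2 + k : ℕ) - n) * ‖z‖ ^ ((2 + k : ℕ) : ℝ) := by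
            rw [Real.rpow_natCast]; ring
        _ = _ := by rw [← Real.rpow_add hz]; ring_nf
  have hpol := integral_polar (integrable_finsetSum Finset.univ fun J _ => hint J)
  have hav : ∀ ξ : Metric.sphere (0 : E n) 1, averageIntegrand s f I x ξ =
      ∫ t in Ioi (0 : ℝ), ((t ^ (n - 1) : ℝ) : ℂ) * ∑ J, φ J (t • (ξ : E n)) := by
    intro ξ
    have hξ : ‖(ξ : E n)‖ = 1 := by simp
    rw [averageIntegrand, beamTransform, ← integral_const_mul]
    refine setIntegral_congr_fun measurableSet_Ioi fun t ht => ?_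
    have ht : 0 < t := ht
    simp only [beamIntegrand, Finset.mul_sum]
    refine Finset.sum_congr rfl fun J _ => ?_
    simp only [hφ, norm_smul, hξ, coord_smul, Real.norm_of_nonneg ht.le, mul_one,
      Finset.prod_mul_distrib, Finset.prod_const, Finset.card_univ, Fintype.card_fin]
    have e : t ^ (2 * s - 1) = t ^ (n - 1) * t ^ (2 * s - (2 + k : ℕ) - n) * (t ^ k * t ^ 2) := by
      rw [← pow_add, ← Real.rpow_natCast, ← Real.rpow_natCast, ← Real.rpow_add ht,
        ← Real.rpow_add ht, Nat.cast_sub hn1]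
      congr 1; push_cast; ring
    rw [e]
    simp only [coord]
    push_cast
    ring
  simp only [← hav] at hpol
  refine ⟨hpol.1, ?_⟩
  rw [average, hpol.2, restrict_compl_singleton, integral_finsetSum _ fun J _ => hint J,
    Finset.mul_sum]

/-- The Fourier transform of a translate. -/
theorem fourier_compSubConst_neg (g : 𝓢(E n, ℂ)) (x y : E n) :
    𝓕 (g.compSubConstCLM ℂ (-x)) y = Real.fourierChar (inner ℝ y x) • 𝓕 g y := by
  have h := congrFun (VectorFourier.fourierIntegral_comp_add_right Real.fourierChar
    (volume : Measure (E n)) (innerₗ (E n)) (g : E n → ℂ) x) y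
  rw [innerₗ_apply_apply, real_inner_comm] at h
  refine Eq.trans ?_ h
  rw [SchwartzMap.fourier_coe]
  have : (⇑(g.compSubConstCLM ℂ (-x)) : E n → ℂ) = (g : E n → ℂ) ∘ fun v => v + x := by
    ext v; simp
  rw [this]; rfl

/-- If the kernels of the averages have Fourier symbols `S J`, then the average is the inverse
Fourier transform of `∑ J, S J * 𝓕 f_J`. -/
theorem average_eq_fourierInv (hn : 2 ≤ n) {s : ℝ} (hs : s ∈ Ioo (0 : ℝ) 1) (f : SymTensorField n 2)
    (I : Fin k → Fin n) {S : (Fin 2 → Fin n) → E n → ℂ}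
    (hSi : ∀ J (g : 𝓢(E n, ℂ)), Integrable fun y => S J y * g y)
    (hS : ∀ J (g : 𝓢(E n, ℂ)), (avgConst n s 2 k : ℂ) *
      ∫ z, ((‖z‖ ^ (2 * s - (2 + k : ℕ) - n) : ℝ) : ℂ) *
        ((∏ a, coord (I a) z) * (∏ a, coord (J a) z) * g z) = ∫ y, S J y * 𝓕 g y) :
    average s f I = 𝓕⁻ (fun y => ∑ J, S J y * 𝓕 (f.comp J) y) := by
  ext x
  rw [(average_eq_sum hn hs f I x).2, Real.fourierInv_eq]
  simp only [Finset.smul_sum]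
  have hJ : ∀ J, (avgConst n s 2 k : ℂ) * ∫ z, ((‖z‖ ^ (2 * s - (2 + k : ℕ) - n) : ℝ) : ℂ) *
        ((∏ a, coord (I a) z) * (∏ a, coord (J a) z) * f.comp J (x + z)) =
      ∫ y, S J y * 𝓕 ((f.comp J).compSubConstCLM ℂ (-x)) y := by
    intro J
    rw [← hS]
    simp only [SchwartzMap.compSubConstCLM_apply, sub_neg_eq_add, add_comm _ x]
  have hsm : ∀ J y, S J y * 𝓕 ((f.comp J).compSubConstCLM ℂ (-x)) y =
      Real.fourierChar (inner ℝ y x) • (S J y * 𝓕 (f.comp J) y) := by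
    intro J y
    rw [fourier_compSubConst_neg, mul_smul_comm]
  rw [integral_finsetSum]
  · refine Finset.sum_congr rfl fun J _ => ?_
    rw [hJ]
    simp only [hsm]
  · intro J _
    simp only [← hsm]
    exact hSi J _

section Distributions

theorem IsGivenBy.unique {T T' : 𝓢'(E n, ℂ)} {u : E n → ℂ} (h : IsGivenBy T u)
    (h' : IsGivenBy T' u) : T = T' := by
  ext φ
  rw [(h φ).2, (h' φ).2]

theorem IsGivenBy.congr {T : 𝓢'(E n, ℂ)} {u v : E n → ℂ} (h : IsGivenBy T u)
    (huv : u =ᵐ[volume] v) : IsGivenBy T v := by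
  intro φ
  have e : (fun x => φ x * u x) =ᵐ[volume] fun x => φ x * v x :=
    huv.mono fun x hx => by simp only [hx]
  exact ⟨(h φ).1.congr e, (h φ).2.trans (integral_congr_ae e)⟩

theorem IsGivenBy.add {T T' : 𝓢'(E n, ℂ)} {u v : E n → ℂ} (h : IsGivenBy T u)
    (h' : IsGivenBy T' v) : IsGivenBy (T + T') (fun x => u x + v x) := by
  intro φ
  have e : ∀ x, φ x * (u x + v x) = φ x * u x + φ x * v x := fun x => mul_add _ _ _
  simp only [e]
  refine ⟨(h φ).1.add (h' φ).1, ?_⟩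
  rw [integral_add (h φ).1 (h' φ).1, ← (h φ).2, ← (h' φ).2]
  rfl

theorem IsGivenBy.smul {T : 𝓢'(E n, ℂ)} {u : E n → ℂ} (h : IsGivenBy T u) (c : ℂ) :
    IsGivenBy (c • T) (fun x => c * u x) := by
  intro φ
  have e : ∀ x, φ x * (c * u x) = c * (φ x * u x) := fun x => by ring
  simp only [e]
  refine ⟨(h φ).1.const_mul c, ?_⟩
  rw [integral_const_mul, ← (h φ).2]
  rfl

theorem IsGivenBy.sub {T T' : 𝓢'(E n, ℂ)} {u v : E n → ℂ} (h : IsGivenBy T u)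
    (h' : IsGivenBy T' v) : IsGivenBy (T - T') (fun x => u x - v x) := by
  have := h.add (h'.smul (-1))
  rw [show T - T' = T + (-1 : ℂ) • T' by module]
  simpa only [neg_one_mul, ← sub_eq_add_neg] using this

/-- A function representing a tempered distribution is locally integrable. -/
theorem IsGivenBy.locallyIntegrable {T : 𝓢'(E n, ℂ)} {u : E n → ℂ} (h : IsGivenBy T u) :
    LocallyIntegrable u := by
  intro x
  let χ : ContDiffBump x := ⟨1, 2, one_pos, one_lt_two⟩
  have h1 : ContDiff ℝ ∞ fun y => (χ y : ℂ) := Complex.ofRealCLM.contDiff.comp χ.contDiff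
  have h2 : HasCompactSupport fun y => (χ y : ℂ) :=
    χ.hasCompactSupport.comp_left Complex.ofReal_zero
  refine ⟨Metric.closedBall x 1, Metric.closedBall_mem_nhds x one_pos, ?_⟩
  refine (h (h2.toSchwartzMap h1)).1.integrableOn.congr_fun (fun y hy => ?_)
    measurableSet_closedBall
  simp [χ.one_of_mem_closedBall hy]

/-- The function representing a tempered distribution is unique almost everywhere. -/
theorem IsGivenBy.ae_eq {T : 𝓢'(E n, ℂ)} {u v : E n → ℂ} (h : IsGivenBy T u)
    (h' : IsGivenBy T v) : u =ᵐ[volume] v := by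
  refine ae_eq_of_integral_contDiff_smul_eq h.locallyIntegrable h'.locallyIntegrable
    fun g hg hgc => ?_
  have hg1 : ContDiff ℝ ∞ fun x => (g x : ℂ) := Complex.ofRealCLM.contDiff.comp hg
  have hg2 : HasCompactSupport fun x => (g x : ℂ) := hgc.comp_left Complex.ofReal_zero
  have h1 := (h (hg2.toSchwartzMap hg1)).2.symm.trans (h' (hg2.toSchwartzMap hg1)).2
  simpa using h1

theorem isGivenBy_of_integrable {u : E n → ℂ} (hu : Integrable u) :
    ∃ T : 𝓢'(E n, ℂ), IsGivenBy T u := by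
  have hm : MemLp u 1 := memLp_one_iff_integrable.2 hu
  refine ⟨((hm.toLp u : Lp ℂ 1 (volume : Measure (E n))) : 𝓢'(E n, ℂ)), fun φ => ⟨?_, ?_⟩⟩
  · obtain ⟨B, hB⟩ := (BoundedContinuousFunction.isBounded_range
      φ.toBoundedContinuousFunction).exists_norm_le
    exact hu.bdd_mul φ.continuous.aestronglyMeasurable
      (Filter.Eventually.of_forall fun x => hB _ ⟨x, rfl⟩)
  · rw [Lp.toTemperedDistribution_apply]
    refine integral_congr_ae (hm.coeFn_toLp.mono fun x hx => ?_)
    simp only [hx, smul_eq_mul]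

theorem isGivenBy_coe (g : 𝓢(E n, ℂ)) : IsGivenBy (g : 𝓢'(E n, ℂ)) g := by
  obtain ⟨T, hT⟩ := isGivenBy_of_integrable (g.integrable (μ := (volume : Measure (E n))))
  exact fun φ => ⟨(hT φ).1, by simp⟩

theorem isGivenBy_fourier_coe (g : 𝓢(E n, ℂ)) : 
    IsGivenBy (𝓕 (g : 𝓢'(E n, ℂ))) (𝓕 g : 𝓢(E n, ℂ)) := by
  rw [TemperedDistribution.fourier_toTemperedDistributionCLM_eq]
  exact isGivenBy_coe _

theorem toDistribution_eq {T : 𝓢'(E n, ℂ)} {u : E n → ℂ} (h : IsGivenBy T u) :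
    toDistribution u = T := by
  have h' : IsTempered u := ⟨T, h⟩
  rw [toDistribution, dif_pos h']
  exact h'.choose_spec.unique h

/-- The inverse Fourier transform of an integrable function is tempered, and its Fourier transform
is the function. -/
theorem isTempered_fourierInv {H : E n → ℂ} (hH : Integrable H) :
    IsTempered (𝓕⁻ H) ∧ IsGivenBy (𝓕 (toDistribution (𝓕⁻ H))) H := by
  obtain ⟨T, hT⟩ := isGivenBy_of_integrable hH
  have hcont : Continuous (𝓕⁻ H) := by
    rw [Real.fourierInv_eq_fourier_comp_neg]
    exact VectorFourier.fourierIntegral_continuous Real.continuous_fourierChar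
      (L := innerₗ (E n)) continuous_inner hH.comp_neg
  have hbdd : ∀ x, ‖𝓕⁻ H x‖ ≤ ∫ y, ‖H y‖ := by
    intro x
    rw [Real.fourierInv_eq]
    refine (norm_integral_le_integral_norm _).trans (le_of_eq ?_)
    simp
  have hinv : IsGivenBy (𝓕⁻ T) (𝓕⁻ H) := by
    intro φ
    refine ⟨?_, ?_⟩
    · have := (φ.integrable (μ := (volume : Measure (E n)))).bdd_mul (f := 𝓕⁻ H)
        hcont.aestronglyMeasurable (Filter.Eventually.of_forall hbdd)
      simpa only [mul_comm] using this
    · rw [TemperedDistribution.fourierInv_apply, (hT _).2, SchwartzMap.fourierInv_coe]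
      have h := VectorFourier.integral_fourierIntegral_smul_eq_flip (L := -innerₗ (E n))
        Real.continuous_fourierChar (continuous_inner (𝕜 := ℝ) (E := E n)).neg
        (φ.integrable (μ := volume)) hH
      have h1 : ∀ u : E n → ℂ, VectorFourier.fourierIntegral Real.fourierChar volume
          (-innerₗ (E n)) u = 𝓕⁻ u := fun u => rfl
      have h2 : (-innerₗ (E n)).flip = -innerₗ (E n) := by
        ext a b; simp [real_inner_comm]
      simpa only [h2, h1, smul_eq_mul] using h
  refine ⟨⟨_, hinv⟩, ?_⟩
  rw [toDistribution_eq hinv, FourierTransform.fourier_fourierInv_eq]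
  exact hT

/-- A multiplier operator whose symbol times the Fourier transform is integrable. -/
theorem multiplier_spec {σ : E n → ℂ} {u : 𝓢'(E n, ℂ)} {U V : E n → ℂ} (hu : IsGivenBy (𝓕 u) U)
    (hV : Integrable V) (hσ : (fun ξ => σ ((2 * Real.pi) • ξ) * U ξ) =ᵐ[volume] V) :
    MultiplierDefined σ u ∧ IsGivenBy (𝓕 (multiplier σ u)) V := by
  obtain ⟨T, hT⟩ := isGivenBy_of_integrable hV
  have hdef : MultiplierDefined σ u := by
    refine ⟨𝓕⁻ T, U, hu, ?_⟩
    rw [FourierTransform.fourier_fourierInv_eq]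
    exact hT.congr hσ.symm
  refine ⟨hdef, ?_⟩
  rw [multiplier, dif_pos hdef]
  obtain ⟨U', hU', hv⟩ := hdef.choose_spec
  refine hv.congr (Filter.EventuallyEq.trans ?_ hσ)
  exact (hU'.ae_eq hu).mono fun x hx => by simp only [hx]

end Distributions

section Symbols

/-- A bounded measurable function. -/
def IsBoundedSymbol (u : E n → ℂ) : Prop := Measurable u ∧ ∃ C, ∀ y, ‖u y‖ ≤ C

theorem isBoundedSymbol_const (c : ℂ) : IsBoundedSymbol fun _ : E n => c :=
  ⟨measurable_const, ‖c‖, fun _ => le_rfl⟩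

theorem IsBoundedSymbol.add {u v : E n → ℂ} (hu : IsBoundedSymbol u) (hv : IsBoundedSymbol v) :
    IsBoundedSymbol fun y => u y + v y := by
  obtain ⟨hu, C, hC⟩ := hu
  obtain ⟨hv, D, hD⟩ := hv
  exact ⟨hu.add hv, C + D, fun y => (norm_add_le _ _).trans (add_le_add (hC y) (hD y))⟩

theorem IsBoundedSymbol.mul {u v : E n → ℂ} (hu : IsBoundedSymbol u) (hv : IsBoundedSymbol v) :
    IsBoundedSymbol fun y => u y * v y := by
  obtain ⟨hu, C, hC⟩ := hu
  obtain ⟨hv, D, hD⟩ := hv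
  refine ⟨hu.mul hv, C * D, fun y => ?_⟩
  rw [norm_mul]
  exact mul_le_mul (hC y) (hD y) (norm_nonneg _) ((norm_nonneg _).trans (hC y))

theorem IsBoundedSymbol.sub {u v : E n → ℂ} (hu : IsBoundedSymbol u) (hv : IsBoundedSymbol v) :
    IsBoundedSymbol fun y => u y - v y := by
  simpa only [neg_one_mul, ← sub_eq_add_neg] using hu.add ((isBoundedSymbol_const (-1)).mul hv)

theorem isBoundedSymbol_dir (j : Fin n) : IsBoundedSymbol (dir j) := by
  refine ⟨?_, 1, fun y => ?_⟩
  · exact (continuous_coord j).measurable.div (Complex.measurable_ofReal.comp measurable_norm)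
  · rw [dir, coord, norm_div, Complex.norm_real, Complex.norm_real, norm_norm]
    exact div_le_one_of_le₀ (PiLp.norm_apply_le y j) (norm_nonneg _)

theorem IsBoundedSymbol.integrable_mul {u H : E n → ℂ} (hu : IsBoundedSymbol u)
    (hH : Integrable H) : Integrable fun y => u y * H y := by
  obtain ⟨hu, C, hC⟩ := hu
  exact hH.bdd_mul hu.aestronglyMeasurable (Filter.Eventually.of_forall hC)

theorem IsBoundedSymbol.integrable_rieszPotential_mul (hn : 2 ≤ n) {s : ℝ}
    (hs : s ∈ Ioo (0 : ℝ) 1) {u : E n → ℂ} (hu : IsBoundedSymbol u) (g : 𝓢(E n, ℂ)) :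
    Integrable fun y => rieszPotentialSymbol s y * u y * g y := by
  have hn' : (2 : ℝ) ≤ n := by exact_mod_cast hn
  have h : Integrable fun y => rieszPotentialSymbol s y * g y := by
    refine integrable_mul_schwartz_of_norm_le_rpow (one_le_finrank (by omega)) (p := -(2 * s))
      (C := (2 * Real.pi) ^ (-(2 * s))) (by simp; linarith [hs.2]) ?_ (fun y _ => ?_) g
    · unfold rieszPotentialSymbol
      exact (Complex.measurable_ofReal.comp
        ((measurable_norm.const_mul _).pow_const _)).aestronglyMeasurable
    · rw [rieszPotentialSymbol, Complex.norm_real, Real.norm_of_nonneg (by positivity),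
        Real.mul_rpow (by positivity) (norm_nonneg _)]
  refine (hu.integrable_mul h).congr (Filter.Eventually.of_forall fun y => ?_)
  simp only
  ring

theorem integrable_symbolTwo_mul (hn : 2 ≤ n) {s : ℝ} (hs : s ∈ Ioo (0 : ℝ) 1) (j k : Fin n)
    (g : 𝓢(E n, ℂ)) : Integrable fun y => symbolTwo s j k y * g y := by
  have hd := isBoundedSymbol_dir (n := n)
  have hc := isBoundedSymbol_const (n := n)
  have hu := (hc (-1)).mul ((hc (kron j k)).sub ((hc (2 * s)).mul ((hd j).mul (hd k))))
  refine (hu.integrable_rieszPotential_mul hn hs g).congr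
    (Filter.Eventually.of_forall fun y => ?_)
  simp only [symbolTwo]
  ring

theorem integrable_symbolThree_mul (hn : 2 ≤ n) {s : ℝ} (hs : s ∈ Ioo (0 : ℝ) 1) (i j k : Fin n)
    (g : 𝓢(E n, ℂ)) : Integrable fun y => symbolThree s i j k y * g y := by
  have hd := isBoundedSymbol_dir (n := n)
  have hc := isBoundedSymbol_const (n := n)
  have hu := (hc (-Complex.I)).mul
    (((((hc (kron j k)).mul (hd i)).add ((hc (kron i k)).mul (hd j))).add
      ((hc (kron i j)).mul (hd k))).sub ((hc (2 * s + 1)).mul (((hd i).mul (hd j)).mul (hd k))))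
  refine (hu.integrable_rieszPotential_mul hn hs g).congr
    (Filter.Eventually.of_forall fun y => ?_)
  simp only [symbolThree]
  ring

theorem integrable_symbolFour_mul (hn : 2 ≤ n) {s : ℝ} (hs : s ∈ Ioo (0 : ℝ) 1)
    (i j k l : Fin n) (g : 𝓢(E n, ℂ)) : Integrable fun y => symbolFour s i j k l y * g y := by
  have hd := isBoundedSymbol_dir (n := n)
  have hc := isBoundedSymbol_const (n := n)
  have hp : ∀ i j k l : Fin n, IsBoundedSymbol fun y => kron i j * (dir k y * dir l y) :=
    fun i j k l => (hc (kron i j)).mul ((hd k).mul (hd l))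
  have hu := (hc (-1)).mul
    (((hc (kron i j * kron k l + kron i k * kron j l + kron i l * kron j k)).sub
      ((hc (2 * s)).mul ((((((hp i j k l).add (hp i k j l)).add (hp i l j k)).add
        (hp j k i l)).add (hp j l i k)).add (hp k l i j)))).add
      ((hc (4 * s * (s + 1))).mul ((((hd i).mul (hd j)).mul (hd k)).mul (hd l))))
  refine (hu.integrable_rieszPotential_mul hn hs g).congr
    (Filter.Eventually.of_forall fun y => ?_)
  simp only [symbolFour]
  ring

end Symbols

section Averages

variable {s : ℝ} (f : SymTensorField n 2)

/-- The Fourier transform of the component `f_{jk}`. -/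
def hat (f : SymTensorField n 2) (j k : Fin n) (y : E n) : ℂ := 𝓕 (f.comp ![j, k]) y

theorem hat_comm (j k : Fin n) (y : E n) : hat f j k y = hat f k j y := by
  have h := f.symm (Equiv.swap 0 1) ![k, j]
  have e : ![k, j] ∘ (Equiv.swap (0 : Fin 2) 1) = ![j, k] := by
    ext a; fin_cases a <;> rfl
  rw [e] at h
  rw [hat, hat, h]

/-- The trace of the Fourier transform of `f`. -/
def hatTrace (y : E n) : ℂ := ∑ j, hat f j j y

/-- The contraction of the Fourier transform of `f` with the direction `y / |y|`. -/
def hatDir (i : Fin n) (y : E n) : ℂ := ∑ j, hat f i j y * dir j y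

/-- The Fourier transform of `f` evaluated twice on the direction `y / |y|`. -/
def hatDirDir (y : E n) : ℂ := ∑ i, dir i y * hatDir f i y

theorem sum_fin_two_arrow (F : (Fin 2 → Fin n) → ℂ) : ∑ J, F J = ∑ j, ∑ k, F ![j, k] := by
  rw [← (finTwoArrowEquiv (Fin n)).symm.sum_comp, Fintype.sum_prod_type]
  rfl

theorem sum_kron_mul (j : Fin n) (F : Fin n → ℂ) : ∑ k, kron j k * F k = F j := by
  simp [kron]

/-- The Fourier transform of `A^0 f`. -/
def avgHatZero (s : ℝ) (y : E n) : ℂ :=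
  -rieszPotentialSymbol s y * (hatTrace f y - 2 * s * hatDirDir f y)

/-- The Fourier transform of `A^{1,i} f`. -/
def avgHatOne (s : ℝ) (i : Fin n) (y : E n) : ℂ :=
  -Complex.I * rieszPotentialSymbol s y *
    (dir i y * hatTrace f y + 2 * hatDir f i y - (2 * s + 1) * (dir i y * hatDirDir f y))

/-- The Fourier transform of `A^{2,ij} f`. -/
def avgHatTwo (s : ℝ) (i j : Fin n) (y : E n) : ℂ :=
  -rieszPotentialSymbol s y *
    (kron i j * hatTrace f y + 2 * hat f i j y
      - 2 * s * (kron i j * hatDirDir f y + dir i y * dir j y * hatTrace f y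
        + 2 * (dir i y * hatDir f j y + dir j y * hatDir f i y))
      + 4 * s * (s + 1) * (dir i y * dir j y * hatDirDir f y))

theorem sum_kron_mul_hat (y : E n) : ∑ j, ∑ k, kron j k * hat f j k y = hatTrace f y := by
  simp only [sum_kron_mul, hatTrace]

theorem sum_dir_mul_hat (y : E n) :
    ∑ j, ∑ k, dir j y * dir k y * hat f j k y = hatDirDir f y := by
  simp only [hatDirDir, hatDir, Finset.mul_sum]
  exact Finset.sum_congr rfl fun j _ => Finset.sum_congr rfl fun k _ => by ring

theorem sum_kron_left (i : Fin n) (y : E n) :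
    ∑ j, ∑ k, kron i j * dir k y * hat f j k y = hatDir f i y := by
  simp only [mul_assoc, ← Finset.mul_sum, sum_kron_mul, hatDir]
  exact Finset.sum_congr rfl fun j _ => mul_comm _ _

theorem sum_kron_right (i : Fin n) (y : E n) :
    ∑ j, ∑ k, kron i k * dir j y * hat f j k y = hatDir f i y := by
  rw [Finset.sum_comm, ← sum_kron_left]
  exact Finset.sum_congr rfl fun j _ => Finset.sum_congr rfl fun k _ => by rw [hat_comm]

theorem sum_kron_kron (i i' : Fin n) (y : E n) :
    ∑ j, ∑ k, kron i j * kron i' k * hat f j k y = hat f i i' y := by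
  simp only [mul_assoc, ← Finset.mul_sum, sum_kron_mul]

theorem sum_symbolTwo (y : E n) :
    ∑ J : Fin 2 → Fin n, symbolTwo s (J 0) (J 1) y * 𝓕 (f.comp J) y = avgHatZero f s y := by
  rw [sum_fin_two_arrow, avgHatZero, ← sum_kron_mul_hat, ← sum_dir_mul_hat]
  simp only [Finset.mul_sum, ← Finset.sum_sub_distrib]
  refine Finset.sum_congr rfl fun j _ => Finset.sum_congr rfl fun k _ => ?_
  simp only [symbolTwo, hat, Matrix.cons_val_zero, Matrix.cons_val_one]
  ring

theorem sum_symbolThree (i : Fin n) (y : E n) :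
    ∑ J : Fin 2 → Fin n, symbolThree s i (J 0) (J 1) y * 𝓕 (f.comp J) y = avgHatOne f s i y := by
  rw [sum_fin_two_arrow, avgHatOne, ← sum_kron_mul_hat, ← sum_dir_mul_hat, two_mul (hatDir f i y)]
  nth_rw 1 [← sum_kron_left]
  nth_rw 1 [← sum_kron_right]
  simp only [Finset.mul_sum, ← Finset.sum_sub_distrib, ← Finset.sum_add_distrib]
  refine Finset.sum_congr rfl fun j _ => Finset.sum_congr rfl fun k _ => ?_
  simp only [symbolThree, hat, Matrix.cons_val_zero, Matrix.cons_val_one]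
  ring

theorem sum_symbolFour (i i' : Fin n) (y : E n) :
    ∑ J : Fin 2 → Fin n, symbolFour s i i' (J 0) (J 1) y * 𝓕 (f.comp J) y =
      avgHatTwo f s i i' y := by
  have e : avgHatTwo f s i i' y = -rieszPotentialSymbol s y *
    (kron i i' * hatTrace f y + (hat f i i' y + hat f i' i y)
      - 2 * s * (kron i i' * hatDirDir f y + dir i y * dir i' y * hatTrace f y
        + (dir i y * (hatDir f i' y + hatDir f i' y) + dir i' y * (hatDir f i y + hatDir f i y)))
      + 4 * s * (s + 1) * (dir i y * dir i' y * hatDirDir f y)) := by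
    rw [avgHatTwo, hat_comm f i' i]; ring
  rw [sum_fin_two_arrow, e, ← sum_kron_mul_hat, ← sum_dir_mul_hat, ← sum_kron_kron f i i',
    ← sum_kron_kron f i' i]
  nth_rw 1 [← sum_kron_left f i']
  nth_rw 1 [← sum_kron_right f i']
  nth_rw 1 [← sum_kron_left f i]
  nth_rw 1 [← sum_kron_right f i]
  simp only [Finset.mul_sum, ← Finset.sum_sub_distrib, ← Finset.sum_add_distrib]
  refine Finset.sum_congr rfl fun j _ => Finset.sum_congr rfl fun k _ => ?_
  simp only [symbolFour, hat, Matrix.cons_val_zero, Matrix.cons_val_one]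
  ring

theorem average_zero (hn : 2 ≤ n) (hs : s ∈ Ioo (0 : ℝ) 1) :
    Integrable (avgHatZero f s) ∧ average s f ![] = 𝓕⁻ (avgHatZero f s) := by
  have hi : ∀ (J : Fin 2 → Fin n) (g : 𝓢(E n, ℂ)),
      Integrable fun y => symbolTwo s (J 0) (J 1) y * g y :=
    fun J g => integrable_symbolTwo_mul hn hs _ _ g
  have h := average_eq_fourierInv hn hs f ![] hi (fun J g => by
    simpa [Fin.prod_univ_two] using avgConst_mul_integral_two hn hs (J 0) (J 1) g)
  have hh := integrable_finsetSum Finset.univ fun J _ => hi J (𝓕 (f.comp J))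
  simp only [sum_symbolTwo] at h hh
  exact ⟨hh, h⟩

theorem average_one (hn : 2 ≤ n) (hs : s ∈ Ioo (0 : ℝ) 1) (i : Fin n) :
    Integrable (avgHatOne f s i) ∧ average s f ![i] = 𝓕⁻ (avgHatOne f s i) := by
  have hi : ∀ (J : Fin 2 → Fin n) (g : 𝓢(E n, ℂ)),
      Integrable fun y => symbolThree s i (J 0) (J 1) y * g y :=
    fun J g => integrable_symbolThree_mul hn hs _ _ _ g
  have h := average_eq_fourierInv hn hs f ![i] hi (fun J g => by
    simpa [Fin.prod_univ_two, mul_assoc] using avgConst_mul_integral_three hn hs i (J 0) (J 1) g)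
  have hh := integrable_finsetSum Finset.univ fun J _ => hi J (𝓕 (f.comp J))
  simp only [sum_symbolThree] at h hh
  exact ⟨hh, h⟩

theorem average_two (hn : 2 ≤ n) (hs : s ∈ Ioo (0 : ℝ) 1) (i j : Fin n) :
    Integrable (avgHatTwo f s i j) ∧ average s f ![i, j] = 𝓕⁻ (avgHatTwo f s i j) := by
  have hi : ∀ (J : Fin 2 → Fin n) (g : 𝓢(E n, ℂ)),
      Integrable fun y => symbolFour s i j (J 0) (J 1) y * g y :=
    fun J g => integrable_symbolFour_mul hn hs _ _ _ _ g
  have h := average_eq_fourierInv hn hs f ![i, j] hi (fun J g => by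
    simpa [Fin.prod_univ_two, mul_assoc] using avgConst_mul_integral_four hn hs i j (J 0) (J 1) g)
  have hh := integrable_finsetSum Finset.univ fun J _ => hi J (𝓕 (f.comp J))
  simp only [sum_symbolFour] at h hh
  exact ⟨hh, h⟩

theorem isTempered_average (hn : 2 ≤ n) (hs : s ∈ Ioo (0 : ℝ) 1) (hk : k ≤ 2)
    (I : Fin k → Fin n) : IsTempered (average s f I) := by
  interval_cases k
  · rw [Subsingleton.elim I ![], (average_zero f hn hs).2]
    exact (isTempered_fourierInv (average_zero f hn hs).1).1
  · rw [show I = ![I 0] by ext a; fin_cases a; rfl, (average_one f hn hs _).2]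
    exact (isTempered_fourierInv (average_one f hn hs _).1).1
  · rw [show I = ![I 0, I 1] by ext a; fin_cases a <;> rfl, (average_two f hn hs _ _).2]
    exact (isTempered_fourierInv (average_two f hn hs _ _).1).1

theorem rieszSymbol_two_pi_smul (j : Fin n) (y : E n) :
    rieszSymbol j ((2 * Real.pi) • y) = -Complex.I * dir j y := by
  rw [rieszSymbol, dir, coord, ← Complex.ofReal_div, norm_smul, Real.norm_of_nonneg (by positivity)]
  congr 2
  rw [PiLp.smul_apply, smul_eq_mul, mul_div_mul_left _ _ (by positivity)]

theorem riesz_spec {u : 𝓢'(E n, ℂ)} {U : E n → ℂ} (hu : IsGivenBy (𝓕 u) U) (hU : Integrable U)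
    (j : Fin n) :
    RieszDefined j u ∧ IsGivenBy (𝓕 (riesz j u)) (fun y => -Complex.I * dir j y * U y) ∧
      Integrable fun y => -Complex.I * dir j y * U y := by
  have hi : Integrable fun y => -Complex.I * dir j y * U y :=
    ((isBoundedSymbol_const _).mul (isBoundedSymbol_dir j)).integrable_mul hU
  have h := multiplier_spec (σ := rieszSymbol j) hu hi
    (Filter.Eventually.of_forall fun y => by simp only [rieszSymbol_two_pi_smul])
  exact ⟨h.1, h.2, hi⟩

theorem fracLaplacianSymbol_mul_rieszPotentialSymbol {s : ℝ} {y : E n} (hy : y ≠ 0) :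
    fracLaplacianSymbol s ((2 * Real.pi) • y) * rieszPotentialSymbol s y = 1 := by
  have h : 0 < 2 * Real.pi * ‖y‖ := mul_pos (by positivity) (norm_pos_iff.2 hy)
  rw [fracLaplacianSymbol, rieszPotentialSymbol, norm_smul, Real.norm_of_nonneg (by positivity),
    ← Complex.ofReal_mul, ← Real.rpow_add h]
  simp

/-- The algebraic identity between the symbols that underlies the reconstruction formula. -/
theorem reconstruction_symbol (s : ℝ) (i₁ i₂ : Fin n) (y : E n) :
    kron i₁ i₂ * avgHatZero f s y
      - 2 * s * (-Complex.I * dir i₁ y * (-Complex.I * dir i₂ y * avgHatZero f s y))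
      - avgHatTwo f s i₁ i₂ y
      - 2 * s * (-Complex.I * dir i₁ y * avgHatOne f s i₂ y
        + -Complex.I * dir i₂ y * avgHatOne f s i₁ y) =
    rieszPotentialSymbol s y * (2 * hat f i₁ i₂ y) := by
  simp only [avgHatZero, avgHatOne, avgHatTwo]
  linear_combination (2 * s * rieszPotentialSymbol s y *
    (dir i₁ y * dir i₂ y * (2 * (1 + s) * hatDirDir f y - hatTrace f y)
      - 2 * (dir i₁ y * hatDir f i₂ y + dir i₂ y * hatDir f i₁ y))) * Complex.I_sq

end Averages

end FracBeam

end

open FracBeam in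
theorem mainTheorem3 {n : ℕ} (hn : 2 ≤ n) {s : ℝ} (hs : s ∈ Set.Ioo (0 : ℝ) 1)
    (hs' : s ≠ 1 / 2) (f : SymTensorField n 2) :
    -- the transform and its averages are well-defined, and the averages are tempered
    (∀ (x : E n) (ξ : Metric.sphere (0 : E n) 1),
      IntegrableOn (beamIntegrand s f x ξ) (Set.Ioi 0)) ∧
    (∀ (k : ℕ), k ≤ 2 → ∀ I : Fin k → Fin n,
      (∀ x : E n, Integrable (averageIntegrand s f I x) (volume : Measure (E n)).toSphere) ∧
      IsTempered (average s f I)) ∧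
    -- the operators in the formula are applied within their domains
    (∀ i j : Fin n, RieszDefined j (averageDist s f ![]) ∧
      RieszDefined i (riesz j (averageDist s f ![])) ∧
      RieszDefined i (averageDist s f ![j])) ∧
    (∀ i₁ i₂ : Fin n, FracLaplacianDefined s
      ((if i₁ = i₂ then (1 : ℂ) else 0) • averageDist s f ![]
        - (2 * s : ℂ) • riesz i₁ (riesz i₂ (averageDist s f ![]))
        - averageDist s f ![i₁, i₂]
        - (2 * s : ℂ) • (riesz i₁ (averageDist s f ![i₂]) + riesz i₂ (averageDist s f ![i₁])))) ∧
    -- the reconstruction formula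
    ∀ i₁ i₂ : Fin n, (f.comp ![i₁, i₂] : 𝓢'(E n, ℂ)) = (1 / 2 : ℂ) • fracLaplacian s
      ((if i₁ = i₂ then (1 : ℂ) else 0) • averageDist s f ![]
        - (2 * s : ℂ) • riesz i₁ (riesz i₂ (averageDist s f ![]))
        - averageDist s f ![i₁, i₂]
        - (2 * s : ℂ) • (riesz i₁ (averageDist s f ![i₂]) + riesz i₂ (averageDist s f ![i₁]))) := by
  obtain ⟨hi0, ha0⟩ := average_zero f hn hs
  have hi1 := fun i => (average_one f hn hs i).1
  have h0 : IsGivenBy (𝓕 (averageDist s f ![])) (avgHatZero f s) := by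
    rw [averageDist, ha0]; exact (isTempered_fourierInv hi0).2
  have h1 : ∀ i, IsGivenBy (𝓕 (averageDist s f ![i])) (avgHatOne f s i) := fun i => by
    rw [averageDist, (average_one f hn hs i).2]; exact (isTempered_fourierInv (hi1 i)).2
  have h2 : ∀ i j, IsGivenBy (𝓕 (averageDist s f ![i, j])) (avgHatTwo f s i j) := fun i j => by
    rw [averageDist, (average_two f hn hs i j).2]
    exact (isTempered_fourierInv (average_two f hn hs i j).1).2
  have hR0 := fun j => riesz_spec h0 hi0 j
  have hRR0 := fun i j => riesz_spec (hR0 j).2.1 (hR0 j).2.2 i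
  have hR1 := fun i j => riesz_spec (h1 j) (hi1 j) i
  have hV : Nontrivial (E n) :=
    Module.nontrivial_of_finrank_pos (R := ℝ) (one_le_finrank (by omega))
  have hne : ∀ᵐ z : E n, z ≠ 0 := by simp [ae_iff]
  have key : ∀ i₁ i₂ : Fin n, _ := fun i₁ i₂ =>
    multiplier_spec (σ := fracLaplacianSymbol s)
      (u := (if i₁ = i₂ then (1 : ℂ) else 0) • averageDist s f ![]
        - (2 * s : ℂ) • riesz i₁ (riesz i₂ (averageDist s f ![]))
        - averageDist s f ![i₁, i₂]
        - (2 * s : ℂ) • (riesz i₁ (averageDist s f ![i₂]) + riesz i₂ (averageDist s f ![i₁])))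
      (U := fun y => rieszPotentialSymbol s y * (2 * hat f i₁ i₂ y))
      (V := fun y => 2 * 𝓕 (f.comp ![i₁, i₂]) y)
      (by
        have hsub : ∀ T T' : 𝓢'(E n, ℂ), 𝓕 (T - T') = 𝓕 T - 𝓕 T' := fun T T' =>
          map_sub (FourierTransform.fourierCLM ℂ 𝓢'(E n, ℂ)) T T'
        simp only [hsub, FourierTransform.fourier_add, FourierTransform.fourier_smul]
        have := (((h0.smul (kron i₁ i₂)).sub ((hRR0 i₁ i₂).2.1.smul (2 * s))).sub
          (h2 i₁ i₂)).sub (((hR1 i₁ i₂).2.1.add (hR1 i₂ i₁).2.1).smul (2 * s))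
        simp only [reconstruction_symbol] at this
        exact this)
      (((𝓕 (f.comp ![i₁, i₂])).integrable).const_mul 2)
      (hne.mono fun y hy => by
        simp only
        rw [← mul_assoc, fracLaplacianSymbol_mul_rieszPotentialSymbol hy, one_mul, hat])
  refine ⟨fun x ξ => integrableOn_beamIntegrand hs.1 f x (by simp), fun k hk I =>
    ⟨fun x => (average_eq_sum hn hs f I x).1, isTempered_average f hn hs hk I⟩,
    fun i j => ⟨(hR0 j).1, (hRR0 i j).1, (hR1 i j).1⟩, fun i₁ i₂ => (key i₁ i₂).1,
    fun i₁ i₂ => ?_⟩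
  have h := (key i₁ i₂).2.smul (1 / 2)
  have hF : 𝓕 (f.comp ![i₁, i₂] : 𝓢'(E n, ℂ)) = 𝓕 ((1 / 2 : ℂ) • fracLaplacian s
      ((if i₁ = i₂ then (1 : ℂ) else 0) • averageDist s f ![]
        - (2 * s : ℂ) • riesz i₁ (riesz i₂ (averageDist s f ![]))
        - averageDist s f ![i₁, i₂]
        - (2 * s : ℂ) • (riesz i₁ (averageDist s f ![i₂]) +
          riesz i₂ (averageDist s f ![i₁])))) := by
    refine (isGivenBy_fourier_coe _).unique ?_
    rw [FourierTransform.fourier_smul]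
    refine h.congr (Filter.Eventually.of_forall fun y => ?_)
    simp only
    ring
  have := congrArg (fun T : 𝓢'(E n, ℂ) => 𝓕⁻ T) hF
  simpa only [FourierTransform.fourierInv_fourier_eq] using this
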